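/- Let $\mathbb{T}^d=\mathbb{R}^d/\mathbb{Z}^d$ with the quotient Euclidean distance, let $\mathcal{P}(X)$ denote the Borel probabilities on $X$ with the narrow topology, let $U,V$ be nonempty compact metric spaces, $T>0$, $I=[0,T]$, and let $f:[0,T]\times\mathbb{T}^d\times\mathcal{P}(\mathbb{T}^d)\times U\times V\to\mathbb{R}^d$ be continuous and such that, for some $L>0$ and all arguments, $$\|f(t,x',m',u,v)-f(t,x'',m'',u,v)\|\le L\bigl(\|x'-x''\|+W_2(m',m'')\bigr),$$ where $W_2$ is the 2-Wasserstein distance. Put $F_1(t,x,m,u)=\mathrm{co}\{f(t,x,m,u,v):v\in V\}$. Let $\mathcal{U}$ (respectively $\mathcal{V}$) be the set of relaxed controls of the first (second) player, i.e. the set of measures on $I\times U$ (respectively $I\times V$) whose marginal on $I$ is Lebesgue measure, with the topology of narrow convergence; $\xi(du|t)$, $\zeta(dv|t)$ denote disintegrations with respect to $t$. A constant control $u\in U$ is identified with the relaxed control $dt\otimes\delta_u$. For $s<r$ in $[0,T]$ let $\mathcal{C}_{s,r}$ be the space of continuous maps $[s,r]\to\mathbb{T}^d$ with the uniform distance. For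 a flow $m:[s,r]\to\mathcal{P}(\mathbb{T}^d)$ let $\mathrm{traj}_{m(\cdot)}^{s,r}(y,\xi,\zeta)\in\mathcal{C}_{s,r}$ be the solution of $$\dot x(t)=\int_U\int_V f(t,x(t),m(t),u,v)\,\zeta(dv|t)\,\xi(du|t),\qquad x(s)=y.$$ A flow $m$ on $[s,r]$ is said to be produced by $s$, $m_*\in\mathcal{P}(\mathbb{T}^d)$ and a probability $\varkappa$ on $\mathbb{T}^d\times\mathcal{U}\times\mathcal{V}$ with first marginal $m_*$ if there is $\chi\in\mathcal{P}(\mathcal{C}_{s,r})$ such that the law of $x(t)$ under $\chi$ is $m(t)$ for all $t\in[s,r]$, $m(s)=m_*$, and $\chi$ is the image of $\varkappa$ under $\mathrm{traj}_{m(\cdot)}^{s,r}$. Let $s,r\in[0,T]$, $s<r$, $m_*\in\mathcal{P}(\mathbb{T}^d)$, let $\alpha$ be a probability on $\mathbb{T}^d\times U$ with marginal $m_*$ on $\mathbb{T}^d$ (a distribution of constant controls of the first player), and let $\mathcal{D}_1[\alpha]$ be the set of probabilities on $\mathbb{T}^d\times\mathcal{U}\times\mathcal{V}$ whose marginal on $\mathbb{T}^d\times\mathcal{U}$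 is $\alpha$ (under the above identification $U\subset\mathcal{U}$). Then a flow $m:[s,r]\to\mathcal{P}(\mathbb{T}^d)$ is produced by $s$, $m_*$ and some $\varkappa\in\mathcal{D}_1[\alpha]$ if and only if there exists a probability $\nu\in\mathcal{P}(\mathcal{C}_{s,r}\times U)$ such that 1. the image of $\nu$ under $(x(\cdot),u)\mapsto(x(s),u)$ is $\alpha$; 2. for every $t\in[s,r]$, the image of $\nu$ under $(x(\cdot),u)\mapsto x(t)$ is $m(t)$; 3. for all $s\le t'\le t''\le r$, $$\int_{\mathcal{C}_{s,r}\times U}\mathrm{dist}\Bigl(x(t'')-x(t'),\int_{t'}^{t''}F_1(t,x(t),m(t),u)\,dt\Bigr)\,\nu(d(x(\cdot),u))=0,$$ where the inner integral is the Aumann integral (the set of the integrals of all integrable selections), and $\mathrm{dist}(z,A)=\inf_{w\in A}\|z-w\|$ for $z\in\mathbb{T}^d$, $A\subset\mathbb{R}^d$, with $\|z-w\|$ the distance on $\mathbb{T}^d$ between $z$ and the class of $w$. -/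

import Mathlib

open MeasureTheory ProbabilityTheory
open scoped ENNReal

noncomputable section

namespace MFDG

/-! ### The state space and the Wasserstein distance -/

/-- The velocity space `ℝ^d` with its Euclidean norm. -/
abbrev Vel (d : ℕ) : Type := EuclideanSpace ℝ (Fin d)

/-- The torus `ℝ^d / ℤ^d`, as the `d`-fold product of `ℝ / ℤ` with the `ℓ²` product metric.
Since the distance on `ℝ / ℤ` is the infimum of the distances of representatives, the distance here
is the infimum of the Euclidean distances of representatives in `ℝ^d`. -/
abbrev Torus (d : ℕ) : Type := PiLp 2 (fun _ : Fin d => UnitAddCircle)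

/-- The quotient map `ℝ^d → ℝ^d / ℤ^d`. -/
def toTorus {d : ℕ} (w : Vel d) : Torus d :=
  WithLp.toLp 2 (fun i => (w i : UnitAddCircle))

/-- The `2`-Wasserstein distance: the square root of the infimum over all transport plans of the
integral of the squared distance. -/
def wasserstein2 {X : Type*} [PseudoMetricSpace X] [MeasurableSpace X]
    (μ₁ μ₂ : ProbabilityMeasure X) : ℝ :=
  Real.sqrt (⨅ π ∈ {π : ProbabilityMeasure (X × X) |
      (π : Measure (X × X)).map Prod.fst = μ₁ ∧ (π : Measure (X × X)).map Prod.snd = μ₂},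
    ∫⁻ p, edist p.1 p.2 ^ 2 ∂(π : Measure (X × X))).toReal

/-- `Λ(X, m, Y)`: the probabilities on `X × Y` whose marginal on `X` is `m`. -/
def withMarginal {X : Type*} [MeasurableSpace X] (m : ProbabilityMeasure X)
    (Y : Type*) [MeasurableSpace Y] : Set (ProbabilityMeasure (X × Y)) :=
  {α | (α : Measure (X × Y)).map Prod.fst = m}

/-! ### Time -/

/-- The time interval `[0, T]`. -/
abbrev Time (T : ℝ) : Type := Set.Icc (0 : ℝ) T

/-- Lebesgue measure on `[0, T]`. -/
def lebTime (T : ℝ) : Measure (Time T) := Measure.comap (fun t : Time T => (t : ℝ)) volume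

instance instIsFiniteMeasureLebTime (T : ℝ) : IsFiniteMeasure (lebTime T) := by
  constructor
  have h : MeasurableEmbedding (fun t : Time T => (t : ℝ)) :=
    MeasurableEmbedding.subtype_coe measurableSet_Icc
  rw [lebTime, h.comap_apply]
  refine lt_of_le_of_lt (measure_mono (t := Set.Icc 0 T) ?_) measure_Icc_lt_top
  rintro _ ⟨t, -, rfl⟩
  exact t.2

/-- Lebesgue measure on `[s, r] ⊆ [0, T]`. -/
def lebSub {T : ℝ} (s r : Time T) : Measure (Set.Icc s r) :=
  Measure.comap (fun t : Set.Icc s r => ((t : Time T) : ℝ)) volume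

/-- The left end point of `[s, r]`. -/
def startPt {T : ℝ} {s r : Time T} (hsr : s < r) : Set.Icc s r := ⟨s, le_refl s, hsr.le⟩

/-- `C_{s,r}`: the continuous functions from `[s, r]` to the torus, with the uniform distance. -/
abbrev Path (d : ℕ) {T : ℝ} (s r : Time T) : Type := C(Set.Icc s r, Torus d)

instance instMeasurableSpacePath (d : ℕ) {T : ℝ} (s r : Time T) :
    MeasurableSpace (Path d s r) := borel _

instance instBorelSpacePath (d : ℕ) {T : ℝ} (s r : Time T) : BorelSpace (Path d s r) := ⟨rfl⟩

/-! ### Relaxed controls -/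

section Controls

variable (T : ℝ) (W : Type*) [MetricSpace W] [CompactSpace W] [MeasurableSpace W] [BorelSpace W]

/-- The relaxed controls `Λ([0, T], λ, W)`: the measures on `[0, T] × W` whose marginal on `[0, T]`
is Lebesgue measure. -/
def RelaxedControl : Type _ :=
  {ξ : FiniteMeasure (Time T × W) // (ξ : Measure (Time T × W)).map Prod.fst = lebTime T}

/-- The topology of narrow convergence. -/
instance instTopologicalSpaceRelaxedControl : TopologicalSpace (RelaxedControl T W) :=
  TopologicalSpace.induced Subtype.val inferInstance

instance instMeasurableSpaceRelaxedControl : MeasurableSpace (RelaxedControl T W) := borel _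

instance instBorelSpaceRelaxedControl : BorelSpace (RelaxedControl T W) := ⟨rfl⟩

variable {T W}

/-- The disintegration `ξ(dw | t)` of a relaxed control. -/
def RelaxedControl.cond [Nonempty W] (ξ : RelaxedControl T W) (t : Time T) : Measure W :=
  (ξ.1 : Measure (Time T × W)).condKernel t

/-- The constant control `w`, regarded as the relaxed control `λ(dt) ⊗ δ_w`. -/
def constControl (w : W) : RelaxedControl T W :=
  ⟨⟨(lebTime T).prod (Measure.dirac w), inferInstance⟩, by
    simp [FiniteMeasure.toMeasure]⟩

theorem continuous_constControl : Continuous (constControl : W → RelaxedControl T W) := by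
  refine continuous_induced_rng.2 (continuous_iff_continuousAt.2 fun w => ?_)
  refine FiniteMeasure.tendsto_iff_forall_integral_tendsto.2 fun g => ?_
  have key : ∀ w : W, ∫ p, g p ∂((lebTime T).prod (Measure.dirac w)) =
      ∫ t, g (t, w) ∂(lebTime T) := by
    intro w
    rw [integral_prod _ (g.integrable _)]
    simp
  change Filter.Tendsto (fun w' : W => ∫ p, g p ∂((lebTime T).prod (Measure.dirac w'))) _
    (nhds (∫ p, g p ∂((lebTime T).prod (Measure.dirac w))))
  simp only [key]
  refine tendsto_integral_filter_of_dominated_convergence (fun _ => ‖g‖) ?_ ?_ ?_ ?_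
  · exact Filter.Eventually.of_forall fun w' =>
      (g.continuous.comp (Continuous.prodMk_left w')).aestronglyMeasurable
  · exact Filter.Eventually.of_forall fun w' => Filter.Eventually.of_forall fun t =>
      g.norm_coe_le_norm _
  · exact integrable_const _
  · exact Filter.Eventually.of_forall fun t =>
      (g.continuous.comp (Continuous.prodMk_right t)).tendsto w

/-- A distribution of constant controls, regarded as a distribution of relaxed controls through the
embedding `constControl`. -/
def toRelaxed {X : Type*} [MeasurableSpace X] (α : ProbabilityMeasure (X × W)) :
    ProbabilityMeasure (X × RelaxedControl T W) :=
  α.map (f := fun p => (p.1, constControl p.2))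
    (measurable_fst.prodMk (continuous_constControl.measurable.comp measurable_snd)).aemeasurable

end Controls

/-! ### Dynamics -/

section Dynamics

variable {d : ℕ} {T : ℝ} {U V : Type*}
  [MetricSpace U] [CompactSpace U] [Nonempty U] [MeasurableSpace U] [BorelSpace U]
  [MetricSpace V] [CompactSpace V] [Nonempty V] [MeasurableSpace V] [BorelSpace V]
  (f : Time T → Torus d → ProbabilityMeasure (Torus d) → U → V → Vel d)
  {s r : Time T} (hsr : s < r)

/-- `F₁(t, x, m, u) = co {f(t, x, m, u, v) : v ∈ V}`. -/
def F₁ (t : Time T) (x : Torus d) (m : ProbabilityMeasure (Torus d)) (u : U) : Set (Vel d) :=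
  convexHull ℝ (Set.range fun v : V => f t x m u v)

/-- The velocity at time `t` of an agent at `x(t)` under the relaxed controls `ξ`, `ζ`. -/
def relaxedVelocity (m : Set.Icc s r → ProbabilityMeasure (Torus d))
    (ξ : RelaxedControl T U) (ζ : RelaxedControl T V) (x : Path d s r) (t : Set.Icc s r) : Vel d :=
  ∫ u, ∫ v, f t (x t) (m t) u v ∂(ζ.cond t) ∂(ξ.cond t)

/-- `x` is the motion on `[s, r]` that starts at `y`, under the flow `m` and the relaxed controls
`ξ`, `ζ`: it solves the initial value problem in the sense of Carathéodory, that is, in integrated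
form. -/
def IsMotion (m : Set.Icc s r → ProbabilityMeasure (Torus d))
    (y : Torus d) (ξ : RelaxedControl T U) (ζ : RelaxedControl T V) (x : Path d s r) : Prop :=
  Integrable (relaxedVelocity f m ξ ζ x) (lebSub s r) ∧
    ∀ t : Set.Icc s r,
      x t = y + toTorus (∫ τ in Set.Icc (startPt hsr) t, relaxedVelocity f m ξ ζ x τ ∂(lebSub s r))

open Classical in
/-- The operator that assigns to an initial state and a pair of relaxed controls the motion on
`[s, r]` (a constant path where there is no motion). -/
def traj (m : Set.Icc s r → ProbabilityMeasure (Torus d))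
    (p : Torus d × RelaxedControl T U × RelaxedControl T V) : Path d s r :=
  if h : ∃ x : Path d s r, IsMotion f hsr m p.1 p.2.1 p.2.2 x then h.choose
  else ContinuousMap.const _ p.1

variable (T U V) in
/-- `𝒟[m_*]`: the distributions of pairs of controls. -/
def controlPairs (mstar : ProbabilityMeasure (Torus d)) :
    Set (ProbabilityMeasure (Torus d × RelaxedControl T U × RelaxedControl T V)) :=
  withMarginal mstar (RelaxedControl T U × RelaxedControl T V)

variable (V) in
/-- `𝒟₁[α]`: the distributions of pairs of controls that are consistent with the distribution `α`
of controls of the first player. -/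
def consistentPairs (mstar : ProbabilityMeasure (Torus d))
    (α : ProbabilityMeasure (Torus d × RelaxedControl T U)) :
    Set (ProbabilityMeasure (Torus d × RelaxedControl T U × RelaxedControl T V)) :=
  {κ ∈ controlPairs T U V mstar |
    (κ : Measure (Torus d × RelaxedControl T U × RelaxedControl T V)).map
      (fun p => (p.1, p.2.1)) = α}

/-- The flow of probabilities `m` on `[s, r]` is produced by `s`, `m_*` and the distribution `κ` of
pairs of controls. -/
def IsProducedBy (mstar : ProbabilityMeasure (Torus d))
    (κ : ProbabilityMeasure (Torus d × RelaxedControl T U × RelaxedControl T V))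
    (m : Set.Icc s r → ProbabilityMeasure (Torus d)) : Prop :=
  ∃ χ : ProbabilityMeasure (Path d s r),
    (∀ t : Set.Icc s r,
      (m t : Measure (Torus d)) = (χ : Measure (Path d s r)).map (fun x => x t)) ∧
    m (startPt hsr) = mstar ∧
    AEMeasurable (traj f hsr m)
      (κ : Measure (Torus d × RelaxedControl T U × RelaxedControl T V)) ∧
    (χ : Measure (Path d s r)) =
      (κ : Measure (Torus d × RelaxedControl T U × RelaxedControl T V)).map (traj f hsr m)

end Dynamics

/-- The (Aumann) integral of a set-valued function: the set of the integrals of its integrable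
selections. -/
def setIntegral {Ω E : Type*} [MeasurableSpace Ω] [NormedAddCommGroup E] [NormedSpace ℝ E]
    (μ : Measure Ω) (F : Ω → Set E) : Set E :=
  {z | ∃ w : Ω → E, Integrable w μ ∧ (∀ᵐ τ ∂μ, w τ ∈ F τ) ∧ z = ∫ τ, w τ ∂μ}

end MFDG

end

noncomputable section

namespace MFDG

open Set Filter Topology

/-! ### Time intervals -/

section TimeInterval

variable {T : ℝ} {s r : Time T}

/-! Both directions transport one measure to the other by an explicit map; once the flow `m` is
given, the problem concerns single paths. Since `m` consists of the time marginals of one law on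
continuous paths, it is continuous, so along it `f` becomes a bounded continuous field, Lipschitz in
the state (`exists_isAdmissible`), and the initial value problem has exactly one solution.

From controls to paths: `κ` is carried by constant controls `u`, and `ν` is its image under (motion,
`u`). The velocity of such a motion is an average of `f` over `V`, so it lies in the closed convex
set `F₁`. Every increment is then an integral of a selection and the distance vanishes pointwise
(`sub_mem_of_isMotion`).

From paths to controls: condition 3 holds for each pair of times separately and involves a distance
not known to be measurable. Measurable minorants of it, built from support functions in countably
many directions, yield almost surely a Lipschitz bound and integral inequalities for all pairs of
times (`ae_hasVelocityBounds`). Lifting the path to Euclidean space and differentiating gives a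
velocity in `F₁` almost everywhere whose integral is the path (`isTrajectory`). By Carathéodory's
theorem and a Borel selection this velocity is the average of `f` over a relaxed control `Z` of the
second player that depends measurably on the path and `u` (`exists_measurable_relaxedControl`). Then
`κ` is the image of `ν` under `(x(s), u, Z)`, and uniqueness of motions shows that `traj` returns
the original path. This also makes the map injective on a set of full measure, so the Lusin–Souslin
theorem makes `traj` almost everywhere measurable for `κ`. -/

instance instCompactSpaceSubinterval : CompactSpace (Icc s r) :=
  isCompact_iff_compactSpace.1 isClosed_Icc.isCompact

theorem measurableEmbedding_coe_subinterval :
    MeasurableEmbedding (fun t : Icc s r => ((t : Time T) : ℝ)) :=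
  (MeasurableEmbedding.subtype_coe measurableSet_Icc).comp
    (MeasurableEmbedding.subtype_coe measurableSet_Icc)

theorem continuous_coe_subinterval : Continuous (fun t : Icc s r => ((t : Time T) : ℝ)) :=
  continuous_subtype_val.comp continuous_subtype_val

/-- The retraction of the real line onto `[s, r]`. -/
def clampTime (hsr : s < r) (x : ℝ) : Icc s r :=
  projIcc s r hsr.le (projIcc 0 T (s.2.1.trans s.2.2) x)

theorem continuous_clampTime (hsr : s < r) : Continuous (clampTime hsr) :=
  continuous_projIcc.comp continuous_projIcc

@[simp]
theorem clampTime_coe (hsr : s < r) (t : Icc s r) :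
    clampTime hsr ((t : Time T) : ℝ) = t := by
  simp [clampTime, projIcc_val]

theorem coe_clampTime (hsr : s < r) {x : ℝ} (h₁ : (s : ℝ) ≤ x) (h₂ : x ≤ r) :
    ((clampTime hsr x : Time T) : ℝ) = x := by
  have h : x = (((⟨⟨x, s.2.1.trans h₁, h₂.trans r.2.2⟩, h₁, h₂⟩ : Icc s r) : Time T) : ℝ) := rfl
  conv_lhs => rw [h, clampTime_coe]

theorem monotone_clampTime (hsr : s < r) : Monotone (clampTime hsr) :=
  (monotone_projIcc _).comp (monotone_projIcc _)

theorem map_coe_lebSub :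
    (lebSub s r).map (fun t : Icc s r => ((t : Time T) : ℝ)) =
      volume.restrict (Icc (s : ℝ) r) := by
  rw [lebSub, measurableEmbedding_coe_subinterval.map_comap]
  congr 1
  ext x
  constructor
  · rintro ⟨t, rfl⟩
    exact t.2
  · intro h
    exact ⟨⟨⟨x, s.2.1.trans h.1, h.2.trans r.2.2⟩, h.1, h.2⟩, rfl⟩

instance instIsFiniteMeasureLebSub : IsFiniteMeasure (lebSub s r) := by
  have : IsFiniteMeasure ((lebSub s r).map (fun t : Icc s r => ((t : Time T) : ℝ))) := by
    rw [map_coe_lebSub]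
    infer_instance
  exact Measure.isFiniteMeasure_of_map measurableEmbedding_coe_subinterval.measurable.aemeasurable

theorem setIntegral_lebSub {E : Type*} [NormedAddCommGroup E] [NormedSpace ℝ E] (h : ℝ → E)
    {a b : Icc s r} (hab : a ≤ b) :
    ∫ τ in Icc a b, h ((τ : Time T) : ℝ) ∂(lebSub s r) =
      ∫ τ in ((a : Time T) : ℝ)..((b : Time T) : ℝ), h τ := by
  have hpre : (fun t : Icc s r => ((t : Time T) : ℝ)) ⁻¹'
      Icc ((a : Time T) : ℝ) ((b : Time T) : ℝ) = Icc a b := rfl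
  have hab' : ((a : Time T) : ℝ) ≤ ((b : Time T) : ℝ) := hab
  rw [← hpre, ← measurableEmbedding_coe_subinterval.setIntegral_map, map_coe_lebSub,
    Measure.restrict_restrict measurableSet_Icc, Icc_inter_Icc,
    max_eq_left (show (s : ℝ) ≤ (a : Time T) from a.2.1),
    min_eq_left (show ((b : Time T) : ℝ) ≤ r from b.2.2),
    intervalIntegral.integral_of_le hab', integral_Icc_eq_integral_Ioc]

theorem setIntegral_lebSub_clampTime {E : Type*} [NormedAddCommGroup E] [NormedSpace ℝ E]
    (hsr : s < r) (h : Icc s r → E) {a b : Icc s r} (hab : a ≤ b) :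
    ∫ τ in Icc a b, h τ ∂(lebSub s r) =
      ∫ τ in ((a : Time T) : ℝ)..((b : Time T) : ℝ), h (clampTime hsr τ) := by
  rw [← setIntegral_lebSub (fun τ => h (clampTime hsr τ)) hab]
  simp

theorem ae_lebSub_iff {p : Icc s r → Prop} (hsr : s < r) :
    (∀ᵐ t ∂(lebSub s r), p t) ↔
      ∀ᵐ x ∂(volume.restrict (Icc (s : ℝ) r)), p (clampTime hsr x) := by
  rw [← map_coe_lebSub, measurableEmbedding_coe_subinterval.ae_map_iff]
  simp

theorem integrable_comp_clampTime {E : Type*} [NormedAddCommGroup E]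
    (hsr : s < r) {h : Icc s r → E} (hh : Integrable h (lebSub s r)) :
    IntegrableOn (fun x => h (clampTime hsr x)) (Icc (s : ℝ) r) := by
  rw [IntegrableOn, ← map_coe_lebSub, measurableEmbedding_coe_subinterval.integrable_map_iff]
  simpa [Function.comp_def] using hh

theorem intervalIntegrable_comp_clampTime {E : Type*} [NormedAddCommGroup E]
    (hsr : s < r) {h : Icc s r → E} (hh : Integrable h (lebSub s r)) (a b : Icc s r) :
    IntervalIntegrable (fun x => h (clampTime hsr x)) volume
      ((a : Time T) : ℝ) ((b : Time T) : ℝ) := by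
  rw [intervalIntegrable_iff]
  refine (integrable_comp_clampTime hsr hh).mono_set fun x hx => ?_
  rcases le_total ((a : Time T) : ℝ) ((b : Time T) : ℝ) with h | h
  · rw [uIoc_of_le h] at hx
    exact ⟨le_trans a.2.1 hx.1.le, hx.2.trans b.2.2⟩
  · rw [uIoc_of_ge h] at hx
    exact ⟨le_trans b.2.1 hx.1.le, hx.2.trans a.2.2⟩

theorem map_val_lebSub :
    (lebSub s r).map (Subtype.val : Icc s r → Time T) = (lebTime T).restrict (Icc s r) := by
  have he : MeasurableEmbedding (Subtype.val : Icc s r → Time T) :=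
    MeasurableEmbedding.subtype_coe measurableSet_Icc
  have he' : MeasurableEmbedding (fun t : Time T => (t : ℝ)) :=
    MeasurableEmbedding.subtype_coe measurableSet_Icc
  have h : lebSub s r = (lebTime T).comap Subtype.val := by
    ext A hA
    rw [he.comap_apply, lebTime, he'.comap_apply, lebSub,
      measurableEmbedding_coe_subinterval.comap_apply, image_image]
  rw [h, he.map_comap, Subtype.range_coe]

theorem ae_lebSub_of_ae_lebTime {p : Time T → Prop} (h : ∀ᵐ t ∂(lebTime T), p t) :
    ∀ᵐ t : Icc s r ∂(lebSub s r), p t :=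
  ae_of_ae_map (f := Subtype.val) measurable_subtype_coe.aemeasurable (by
    rw [map_val_lebSub]
    exact ae_restrict_of_ae h)

theorem lebSub_Icc (a b : Icc s r) :
    (lebSub s r) (Icc a b) = ENNReal.ofReal (((b : Time T) : ℝ) - ((a : Time T) : ℝ)) := by
  have hpre : (fun t : Icc s r => ((t : Time T) : ℝ)) ⁻¹'
      Icc ((a : Time T) : ℝ) ((b : Time T) : ℝ) = Icc a b := rfl
  rw [← hpre, ← measurableEmbedding_coe_subinterval.map_apply, map_coe_lebSub,
    Measure.restrict_apply measurableSet_Icc, inter_eq_left.2, Real.volume_Icc]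
  exact Icc_subset_Icc a.2.1 b.2.2

end TimeInterval

/-! ### The torus -/

section Torus

variable {d : ℕ}

instance instCompactSpaceTorus : CompactSpace (Torus d) :=
  (PiLp.homeomorph 2 (fun _ : Fin d => UnitAddCircle)).symm.compactSpace

@[simp]
theorem toTorus_apply (w : Vel d) (i : Fin d) : toTorus w i = (w i : UnitAddCircle) := rfl

@[simp]
theorem toTorus_zero : toTorus (0 : Vel d) = 0 := by
  ext i; simp

theorem toTorus_add (v w : Vel d) : toTorus (v + w) = toTorus v + toTorus w := by
  ext i; simp

theorem toTorus_sub (v w : Vel d) : toTorus (v - w) = toTorus v - toTorus w := by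
  ext i; simp

theorem norm_toTorus_le (w : Vel d) : ‖toTorus w‖ ≤ ‖w‖ := by
  rw [PiLp.norm_eq_of_L2, EuclideanSpace.norm_eq]
  gcongr with i
  exact QuotientAddGroup.norm_mk_le_norm

theorem norm_toTorus {w : Vel d} (hw : ‖w‖ ≤ 1 / 2) : ‖toTorus w‖ = ‖w‖ := by
  rw [PiLp.norm_eq_of_L2, EuclideanSpace.norm_eq]
  congr 1
  refine Finset.sum_congr rfl fun i _ => ?_
  rw [toTorus_apply, (AddCircle.norm_coe_eq_abs_iff 1 one_ne_zero).2, Real.norm_eq_abs]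
  simpa using (PiLp.norm_apply_le w i).trans hw

theorem lipschitzWith_toTorus : LipschitzWith 1 (toTorus : Vel d → Torus d) :=
  LipschitzWith.of_dist_le_mul fun v w => by
    simpa [dist_eq_norm, ← toTorus_sub] using norm_toTorus_le (v - w)

theorem continuous_toTorus : Continuous (toTorus : Vel d → Torus d) :=
  lipschitzWith_toTorus.continuous

/-- The representative of a point of the torus of the least norm. -/
def rep (z : Torus d) : Vel d :=
  WithLp.toLp 2 (fun i => (AddCircle.measurableEquivIoc 1 (-(1 / 2)) (z i) : ℝ))

@[simp]
theorem toTorus_rep (z : Torus d) : toTorus (rep z) = z := by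
  ext i
  exact (AddCircle.measurableEquivIoc 1 (-(1 / 2))).symm_apply_apply (z i)

theorem measurable_rep : Measurable (rep : Torus d → Vel d) := by
  refine (PiLp.continuous_toLp 2 _).measurable.comp (measurable_pi_lambda _ fun i => ?_)
  exact measurable_subtype_coe.comp ((AddCircle.measurableEquivIoc 1 _).measurable.comp
    (PiLp.continuous_apply 2 _ i).measurable)

theorem abs_rep_apply_le (z : Torus d) (i : Fin d) : |rep z i| ≤ 1 / 2 := by
  have h := (AddCircle.measurableEquivIoc 1 (-(1 / 2)) (z i)).2
  rw [abs_le]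
  exact ⟨h.1.le, h.2.trans (by norm_num)⟩

@[simp]
theorem norm_rep (z : Torus d) : ‖rep z‖ = ‖z‖ := by
  rw [EuclideanSpace.norm_eq, PiLp.norm_eq_of_L2]
  congr 1
  refine Finset.sum_congr rfl fun i _ => ?_
  conv_rhs => rw [← toTorus_rep z, toTorus_apply]
  rw [(AddCircle.norm_coe_eq_abs_iff 1 one_ne_zero).2, Real.norm_eq_abs]
  simpa using abs_rep_apply_le z i

/-- The quotient map is injective on balls of radius `1 / 4`, in the form for differences. -/
theorem eq_of_toTorus_eq {v w : Vel d} (h : toTorus v = toTorus w) (hvw : ‖v - w‖ ≤ 1 / 2) :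
    v = w := by
  rw [← sub_eq_zero, ← norm_eq_zero, ← norm_toTorus hvw, toTorus_sub, h, sub_self, norm_zero]

/-- With the radius 1/4, `w` and the representative differ by at most 1/2, the range where the
quotient map preserves norms. -/
theorem rep_toTorus {w : Vel d} (hw : ‖w‖ ≤ 1 / 4) : rep (toTorus w) = w := by
  refine eq_of_toTorus_eq (toTorus_rep _) ((norm_sub_le _ _).trans ?_)
  rw [norm_rep]
  linarith [norm_toTorus_le w]

/-- On this ball `rep` is an isometry. This makes lifts of short increments Lipschitz and makes
`rep` continuous where limits are taken. -/
theorem norm_rep_sub_rep {z z' : Torus d} (hz : ‖z‖ ≤ 1 / 4) (hz' : ‖z'‖ ≤ 1 / 4) :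
    ‖rep z - rep z'‖ = ‖z - z'‖ := by
  rw [← norm_toTorus, toTorus_sub, toTorus_rep, toTorus_rep]
  refine (norm_sub_le _ _).trans ?_
  rw [norm_rep, norm_rep]
  linarith

end Torus

/-! ### Carathéodory differential equations on the torus -/

section Ode

variable {d : ℕ} {T : ℝ} {s r : Time T}

/-- The velocity fields that are measurable along continuous paths, bounded by `M`, and
`L`-Lipschitz in the state. -/
structure IsCaratheodory (φ : Icc s r → Torus d → Vel d) (M L : ℝ) : Prop where
  aestronglyMeasurable : ∀ x : Path d s r,
    AEStronglyMeasurable (fun t => φ t (x t)) (lebSub s r)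
  norm_le : ∀ t y, ‖φ t y‖ ≤ M
  lipschitz : ∀ t y z, ‖φ t y - φ t z‖ ≤ L * dist y z
  nonneg : 0 ≤ L

variable {φ : Icc s r → Torus d → Vel d} {M L : ℝ}

theorem IsCaratheodory.integrable (h : IsCaratheodory φ M L) (x : Path d s r) :
    Integrable (fun t => φ t (x t)) (lebSub s r) :=
  .of_bound (h.aestronglyMeasurable x) M (.of_forall fun t => h.norm_le t _)

theorem startPt_le (hsr : s < r) (t : Icc s r) : startPt hsr ≤ t := t.2.1

theorem continuous_primitive {E : Type*} [NormedAddCommGroup E] [NormedSpace ℝ E] (hsr : s < r)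
    {w : Icc s r → E}
    (hw : Integrable w (lebSub s r)) :
    Continuous fun t : Icc s r => ∫ τ in Icc (startPt hsr) t, w τ ∂(lebSub s r) := by
  simp_rw [fun t : Icc s r => setIntegral_lebSub_clampTime hsr w (startPt_le hsr t)]
  have h := intervalIntegral.continuousOn_primitive_interval'
    (intervalIntegrable_comp_clampTime hsr hw (startPt hsr) ⟨r, hsr.le, le_rfl⟩) left_mem_uIcc
  refine h.comp_continuous continuous_coe_subinterval fun t => ?_
  rw [uIcc_of_le (show ((startPt hsr : Time T) : ℝ) ≤ r from hsr.le)]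
  exact t.2

theorem primitive_sub_primitive {E : Type*} [NormedAddCommGroup E] [NormedSpace ℝ E]
    (hsr : s < r) {w : Icc s r → E} (hw : Integrable w (lebSub s r))
    {a b : Icc s r} (hab : a ≤ b) :
    ∫ τ in Icc (startPt hsr) b, w τ ∂(lebSub s r) - ∫ τ in Icc (startPt hsr) a, w τ ∂(lebSub s r) =
      ∫ τ in Icc a b, w τ ∂(lebSub s r) := by
  rw [setIntegral_lebSub_clampTime hsr w (startPt_le hsr b),
    setIntegral_lebSub_clampTime hsr w (startPt_le hsr a),
    setIntegral_lebSub_clampTime hsr w hab, intervalIntegral.integral_interval_sub_left]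
  all_goals exact intervalIntegrable_comp_clampTime hsr hw _ _

/-- The Picard operator. -/
def picard (hsr : s < r) (h : IsCaratheodory φ M L) (y : Torus d) (x : Path d s r) :
    Path d s r where
  toFun t := y + toTorus (∫ τ in Icc (startPt hsr) t, φ τ (x τ) ∂(lebSub s r))
  continuous_toFun := continuous_const.add
    (continuous_toTorus.comp (continuous_primitive hsr (h.integrable x)))

theorem dist_picard_le (hsr : s < r) (h : IsCaratheodory φ M L) (y : Torus d)
    (x z : Path d s r) (t : Icc s r) :
    dist (picard hsr h y x t) (picard hsr h y z t) ≤
      ∫ τ in (s : ℝ)..((t : Time T) : ℝ),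
        L * dist (x (clampTime hsr τ)) (z (clampTime hsr τ)) := by
  have hst := startPt_le hsr t
  simp only [picard, ContinuousMap.coe_mk]
  rw [dist_add_left, dist_eq_norm, ← toTorus_sub,
    ← integral_sub (h.integrable x).integrableOn (h.integrable z).integrableOn]
  refine (norm_toTorus_le _).trans ?_
  rw [setIntegral_lebSub_clampTime hsr (fun τ => φ τ (x τ) - φ τ (z τ)) hst]
  refine intervalIntegral.norm_integral_le_of_norm_le (show (s : ℝ) ≤ _ from hst)
    (.of_forall fun τ _ => h.lipschitz _ _ _) (Continuous.intervalIntegrable ?_ _ _)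
  have := continuous_clampTime hsr
  fun_prop

theorem dist_picard_iterate_le (hsr : s < r) (h : IsCaratheodory φ M L) (y : Torus d)
    (x z : Path d s r) (n : ℕ) (t : Icc s r) :
    dist ((picard hsr h y)^[n] x t) ((picard hsr h y)^[n] z t) ≤
      (L * (((t : Time T) : ℝ) - s)) ^ n / n.factorial * dist x z := by
  induction n generalizing t with
  | zero => simpa using ContinuousMap.dist_apply_le_dist t
  | succ n ih =>
    rw [Function.iterate_succ_apply', Function.iterate_succ_apply']
    refine (dist_picard_le hsr h y _ _ t).trans ?_
    have hst : (s : ℝ) ≤ ((t : Time T) : ℝ) := startPt_le hsr t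
    have hc := continuous_clampTime hsr
    calc
      _ ≤ ∫ τ in (s : ℝ)..((t : Time T) : ℝ),
          L * ((L * (τ - s)) ^ n / n.factorial * dist x z) := by
        refine intervalIntegral.integral_mono_on hst
          (Continuous.intervalIntegrable (by fun_prop) _ _)
          (Continuous.intervalIntegrable (by fun_prop) _ _) fun τ hτ => ?_
        refine mul_le_mul_of_nonneg_left ((ih _).trans_eq ?_) h.nonneg
        rw [coe_clampTime hsr hτ.1 (hτ.2.trans t.2.2)]
      _ = ∫ τ in (s : ℝ)..((t : Time T) : ℝ),
          (L ^ (n + 1) / n.factorial * dist x z) * (τ - s) ^ n := by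
        refine intervalIntegral.integral_congr fun τ _ => ?_
        simp only [mul_pow]
        ring
      _ = _ := by
        rw [intervalIntegral.integral_const_mul,
          intervalIntegral.integral_comp_sub_right (fun τ => τ ^ n) (s : ℝ), integral_pow,
          Nat.factorial_succ, mul_pow]
        push_cast
        field_simp
        simp

/-- Iterating the integral estimate produces a factorial in the denominator, so a high enough power
contracts in the uniform distance whatever the length of `[s, r]`. -/
theorem exists_contractingWith_picard_iterate (hsr : s < r) (h : IsCaratheodory φ M L)
    (y : Torus d) : ∃ n, ContractingWith (1 / 2) (picard hsr h y)^[n] := by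
  obtain ⟨n, hn⟩ := ((FloorSemiring.tendsto_pow_div_factorial_atTop
    (L * ((r : ℝ) - s))).eventually (gt_mem_nhds (show (0 : ℝ) < 1 / 2 by norm_num))).exists
  refine ⟨n, by norm_num [← NNReal.coe_lt_coe], LipschitzWith.of_dist_le_mul fun x z => ?_⟩
  refine (ContinuousMap.dist_le (by positivity)).2 fun t => ?_
  refine (dist_picard_iterate_le hsr h y x z n t).trans
    (mul_le_mul_of_nonneg_right (le_trans ?_ hn.le) dist_nonneg |>.trans_eq (by simp))
  have h₁ : 0 ≤ ((t : Time T) : ℝ) - s := sub_nonneg.2 t.2.1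
  have h₂ : ((t : Time T) : ℝ) ≤ r := t.2.2
  have := h.nonneg
  gcongr

theorem existsUnique_picard_fixed (hsr : s < r) (h : IsCaratheodory φ M L) (y : Torus d) :
    ∃! x : Path d s r, ∀ t,
      x t = y + toTorus (∫ τ in Icc (startPt hsr) t, φ τ (x τ) ∂(lebSub s r)) := by
  obtain ⟨n, hn⟩ := exists_contractingWith_picard_iterate hsr h y
  have : Nonempty (Path d s r) := ⟨ContinuousMap.const _ y⟩
  refine ⟨_, fun t => (DFunLike.congr_fun hn.isFixedPt_fixedPoint_iterate t).symm,
    fun x hx => hn.fixedPoint_unique ?_⟩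
  exact Function.IsFixedPt.iterate (ContinuousMap.ext fun t => (hx t).symm) n

end Ode

/-! ### Measurable selections -/

section Selection

/-- In base 1/3 each digit outweighs the whole tail after it, whence injectivity. The map transfers
the order of the line to the Cantor space, so that a least element can be selected. -/
theorem exists_continuous_injective_nat_bool_real :
    ∃ c : (ℕ → Bool) → ℝ, Continuous c ∧ Function.Injective c := by
  refine ⟨Cardinal.cantorFunction (1 / 3), ?_,
    Cardinal.cantorFunction_injective (by norm_num) (by norm_num)⟩
  refine continuous_tsum (u := fun n => (1 / 3 : ℝ) ^ n) (fun n => ?_)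
    (summable_geometric_of_lt_one (by norm_num) (by norm_num)) fun n b => ?_
  · exact (continuous_of_discreteTopology
      (f := fun a : Bool => cond a ((1 / 3 : ℝ) ^ n) 0)).comp (continuous_apply n)
  · cases h : b n <;> simp [Cardinal.cantorFunctionAux, h]

/-- A closed relation with compact metrizable fibres has a Borel selection. -/
theorem exists_measurable_selection {Q S : Type*} [TopologicalSpace Q] [MeasurableSpace Q]
    [OpensMeasurableSpace Q] [MetricSpace S] [CompactSpace S] [Nonempty S] [MeasurableSpace S]
    [BorelSpace S] {G : Set (Q × S)} (hG : IsClosed G) :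
    ∃ σ : Q → S, Measurable σ ∧ ∀ q, (∃ s, (q, s) ∈ G) → (q, σ q) ∈ G := by
  obtain ⟨φ, hφ, hφs⟩ := exists_nat_bool_continuous_surjective_of_compact S
  obtain ⟨c, hc, hci⟩ := exists_continuous_injective_nat_bool_real
  let : MeasurableSpace (ℕ → Bool) := borel _
  have : BorelSpace (ℕ → Bool) := ⟨rfl⟩
  obtain ⟨ψ, hψ, hψc⟩ := (hc.isClosedEmbedding hci).measurableEmbedding.exists_measurable_extend
    (g := φ) hφ.measurable fun _ => ‹Nonempty S›
  -- `A q` is the compact set of real codes of the points in the fibre over `q`; the selection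
  -- decodes the least one.
  let A : Q → Set ℝ := fun q => c '' {b | (q, φ b) ∈ G}
  have hAc : ∀ q, IsCompact (A q) := fun q =>
    ((hG.preimage (by fun_prop : Continuous fun b => (q, φ b))).isCompact).image hc
  -- The points whose fibre has a code at most `a` form the projection of a closed set along a
  -- compact factor.
  have hproj : ∀ a : ℝ, IsClosed {q | ∃ b, c b ≤ a ∧ (q, φ b) ∈ G} := by
    intro a
    have h₁ : IsClosed {p : Q × (ℕ → Bool) | c p.2 ≤ a ∧ (p.1, φ p.2) ∈ G} :=
      (isClosed_le (hc.comp continuous_snd) continuous_const).and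
        (hG.preimage (by fun_prop : Continuous fun p : Q × (ℕ → Bool) => (p.1, φ p.2)))
    convert isClosedMap_fst_of_compactSpace _ h₁ using 1
    ext q
    simp
  have hne : MeasurableSet {q | (A q).Nonempty} := by
    have h₁ : IsClosed {p : Q × (ℕ → Bool) | (p.1, φ p.2) ∈ G} :=
      hG.preimage (by fun_prop : Continuous fun p : Q × (ℕ → Bool) => (p.1, φ p.2))
    convert (isClosedMap_fst_of_compactSpace _ h₁).measurableSet using 1
    ext q
    simp [A, Set.Nonempty]
  have hmem : ∀ q, (A q).Nonempty → sInf (A q) ∈ A q := fun q h => (hAc q).sInf_mem h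
  refine ⟨fun q => ψ (sInf (A q)), hψ.comp (measurable_of_Iic fun a => ?_), fun q => ?_⟩
  -- The second set accounts for empty fibres, where `sInf ∅ = 0`.
  · have : (fun q => sInf (A q)) ⁻¹' Iic a =
        {q | ∃ b, c b ≤ a ∧ (q, φ b) ∈ G} ∪ ({q | (A q).Nonempty}ᶜ ∩ {_q | 0 ≤ a}) := by
      ext q
      by_cases hq : (A q).Nonempty
      · simp only [mem_preimage, mem_Iic, mem_union, mem_ofPred_eq, mem_inter_iff, mem_compl_iff,
          hq, not_true_eq_false, false_and, or_false]
        constructor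
        · intro h
          obtain ⟨b, hb, hbq⟩ := hmem q hq
          exact ⟨b, hbq.trans_le h, hb⟩
        · rintro ⟨b, hb, hbG⟩
          exact (csInf_le (hAc q).bddBelow ⟨b, hbG, rfl⟩).trans hb
      · have hq' : A q = ∅ := not_nonempty_iff_eq_empty.1 hq
        have hn : ¬ ∃ b, c b ≤ a ∧ (q, φ b) ∈ G := by
          rintro ⟨b, -, hb⟩
          exact hq ⟨_, b, hb, rfl⟩
        simp only [mem_preimage, mem_Iic, mem_union, mem_ofPred_eq, mem_inter_iff, mem_compl_iff,
          hq, hn, not_false_eq_true, true_and, false_or]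
        rw [hq', Real.sInf_empty]
    rw [this]
    exact (hproj a).measurableSet.union (hne.compl.inter (.const _))
  · rintro ⟨s, hs⟩
    obtain ⟨b, rfl⟩ := hφs s
    obtain ⟨b', hb', hbq⟩ := hmem q ⟨_, b, hs, rfl⟩
    beta_reduce
    rw [← hbq, show ψ (c b') = φ b' from congr_fun hψc b']
    exact hb'

end Selection

/-! ### Convex hulls of compact sets -/

section Caratheodory

variable {E V : Type*} [NormedAddCommGroup E] [NormedSpace ℝ E]

/-- The parameters of convex combinations of `n` points of `V`. -/
abbrev ConvexParam (n : ℕ) (V : Type*) : Type _ := stdSimplex ℝ (Fin n) × (Fin n → V)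

/-- The convex combination of the values of `g` with given parameters. -/
def convexCombo {n : ℕ} (g : V → E) (p : ConvexParam n V) : E := ∑ i, p.1 i • g (p.2 i)

theorem convexCombo_mem_convexHull {n : ℕ} (g : V → E) (p : ConvexParam n V) :
    convexCombo g p ∈ convexHull ℝ (range g) :=
  (convex_convexHull ℝ _).sum_mem (fun i _ => p.1.2.1 i) p.1.2.2
    fun _ _ => subset_convexHull ℝ _ (mem_range_self _)

/-- Carathéodory's theorem gives affinely independent points, hence at most dimension plus one of
them; zero weights pad the family to a fixed length. The hull becomes the image of one compact
parameter space. -/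
theorem exists_convexCombo_eq [FiniteDimensional ℝ E] [Nonempty V] (g : V → E) {w : E}
    (hw : w ∈ convexHull ℝ (range g)) :
    ∃ p : ConvexParam (Module.finrank ℝ E + 1) V, convexCombo g p = w := by
  obtain ⟨ι, _, z, c, hz, hind, hc, hc1, rfl⟩ := eq_pos_convex_span_of_mem_convexHull hw
  have hcard : Fintype.card ι ≤ Fintype.card (Fin (Module.finrank ℝ E + 1)) := by
    rw [Fintype.card_fin]
    exact hind.card_le_finrank_succ.trans (by gcongr; exact Submodule.finrank_le _)
  obtain ⟨e⟩ := Function.Embedding.nonempty_of_card_le hcard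
  choose v hv using fun i => hz (mem_range_self i)
  refine ⟨⟨⟨Function.extend e c 0, fun j => ?_, ?_⟩,
    Function.extend e v fun _ => Classical.arbitrary V⟩, ?_⟩
  · by_cases hj : j ∈ range e
    · obtain ⟨i, rfl⟩ := hj
      rw [e.injective.extend_apply]
      exact (hc i).le
    · rw [Function.extend_apply' _ _ _ hj]
      rfl
  · rw [← hc1]
    refine (Fintype.sum_of_injective e e.injective _ _ (fun j hj => ?_) fun i => ?_).symm
    · exact Function.extend_apply' _ _ _ hj
    · exact (e.injective.extend_apply _ _ _).symm
  · refine (Fintype.sum_of_injective e e.injective _ _ (fun j hj => ?_) fun i => ?_).symm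
    · change Function.extend e c 0 j • _ = (0 : E)
      rw [Function.extend_apply' _ _ _ hj]
      exact zero_smul _ _
    · change c i • z i =
        Function.extend e c 0 (e i) • g (Function.extend e v (fun _ => Classical.arbitrary V) (e i))
      rw [e.injective.extend_apply, e.injective.extend_apply, hv]

theorem continuous_convexCombo [TopologicalSpace V] {n : ℕ} {X : Type*} [TopologicalSpace X]
    {g : X → V → E} (hg : Continuous fun q : X × V => g q.1 q.2) :
    Continuous fun q : X × ConvexParam n V => convexCombo (g q.1) q.2 := by
  unfold convexCombo
  refine continuous_finsetSum _ fun i _ => ?_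
  exact ((continuous_apply i).comp
    (continuous_subtype_val.comp (continuous_fst.comp continuous_snd))).smul
      (hg.comp (continuous_fst.prodMk
        ((continuous_apply i).comp (continuous_snd.comp continuous_snd))))

theorem isCompact_convexHull_range [FiniteDimensional ℝ E] [TopologicalSpace V] [CompactSpace V] [Nonempty V] {g : V → E}
    (hg : Continuous g) : IsCompact (convexHull ℝ (range g)) := by
  have h : convexHull ℝ (range g) =
      range (convexCombo g : ConvexParam (Module.finrank ℝ E + 1) V → E) := by
    ext w
    exact ⟨exists_convexCombo_eq g, by rintro ⟨p, rfl⟩; exact convexCombo_mem_convexHull g p⟩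
  rw [h]
  exact isCompact_range ((continuous_convexCombo (X := Unit) (g := fun _ => g)
    (hg.comp continuous_snd)).comp (Continuous.prodMk_right ()))

end Caratheodory

/-! ### The space of relaxed controls -/

section RelaxedControls

theorem RelaxedControl.measure_univ {T : ℝ} {W : Type*} [MeasurableSpace W] (ξ : RelaxedControl T W) :
    (ξ.1 : Measure (Time T × W)) univ = lebTime T univ := by
  have h := congr_arg (fun μ : Measure (Time T) => μ univ) ξ.2
  simpa [Measure.map_apply measurable_fst] using h

variable {T : ℝ} {W : Type*} [MetricSpace W] [CompactSpace W] [MeasurableSpace W] [BorelSpace W]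

/-- The measure underlying a relaxed control. -/
def RelaxedControl.toFiniteMeasure (ξ : RelaxedControl T W) : FiniteMeasure (Time T × W) := ξ.1

theorem RelaxedControl.isEmbedding_toFiniteMeasure :
    IsEmbedding (RelaxedControl.toFiniteMeasure : RelaxedControl T W → _) :=
  ⟨⟨rfl⟩, Subtype.val_injective⟩

theorem RelaxedControl.continuous_integral (g : C(Time T × W, ℝ)) :
    Continuous fun ξ : RelaxedControl T W => ∫ p, g p ∂(ξ.1 : Measure (Time T × W)) :=
  continuous_iff_continuousAt.2 fun ξ =>
    FiniteMeasure.tendsto_iff_forall_integral_tendsto.1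
      (continuous_induced_dom.tendsto ξ) (BoundedContinuousFunction.mkOfCompact g)

theorem RelaxedControl.abs_integral_sub_le (ξ : RelaxedControl T W) (g h : C(Time T × W, ℝ)) :
    |∫ p, g p ∂(ξ.1 : Measure (Time T × W)) - ∫ p, h p ∂(ξ.1 : Measure (Time T × W))| ≤
      dist g h * (lebTime T).real univ := by
  have hi : ∀ k : C(Time T × W, ℝ), Integrable k (ξ.1 : Measure (Time T × W)) := fun k =>
    (BoundedContinuousFunction.mkOfCompact k).integrable _
  rw [← integral_sub (hi g) (hi h), ← Real.norm_eq_abs, measureReal_def, ← ξ.measure_univ,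
    ← measureReal_def]
  refine norm_integral_le_of_norm_le_const (.of_forall fun p => ?_)
  rw [← dist_eq_norm]
  exact ContinuousMap.dist_apply_le_dist p

/-- The integrals of the members of a countable dense family of test functions. -/
def RelaxedControl.moments (ξ : RelaxedControl T W) (n : ℕ) : ℝ :=
  haveI : Nonempty C(Time T × W, ℝ) := ⟨0⟩
  ∫ p, TopologicalSpace.denseSeq C(Time T × W, ℝ) n p ∂(ξ.1 : Measure (Time T × W))

/-- All relaxed controls have the same mass, so replacing a test function by a uniformly close one
from a countable dense family changes all integrals by a uniformly small amount. Countably many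
integrals therefore determine the topology, and with it the Borel structure. -/
theorem RelaxedControl.isInducing_moments :
    IsInducing (RelaxedControl.moments : RelaxedControl T W → ℕ → ℝ) := by
  have : Nonempty C(Time T × W, ℝ) := ⟨0⟩
  refine isInducing_iff_nhds.2 fun ξ => le_antisymm ?_ ?_
  · exact (tendsto_iff_comap.1 ((continuous_pi fun n =>
      RelaxedControl.continuous_integral _).tendsto ξ))
  · rw [RelaxedControl.isEmbedding_toFiniteMeasure.nhds_eq_comap,
      ← tendsto_iff_comap, FiniteMeasure.tendsto_iff_forall_integral_tendsto]
    intro f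
    refine Metric.tendsto_nhds.2 fun ε hε => ?_
    set c := (lebTime T).real univ with hc
    have hc0 : 0 ≤ c := measureReal_nonneg
    -- The summand 1 keeps the denominator positive even when the mass `c` vanishes.
    obtain ⟨n, hn⟩ := (TopologicalSpace.denseRange_denseSeq C(Time T × W, ℝ)).exists_dist_lt
      f.toContinuousMap (show 0 < ε / (3 * (c + 1)) by positivity)
    have hsmall : dist f.toContinuousMap (TopologicalSpace.denseSeq C(Time T × W, ℝ) n) * c ≤
        ε / 3 := by
      calc _ ≤ ε / (3 * (c + 1)) * (c + 1) := by gcongr; linarith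
        _ = ε / 3 := by field_simp
    have ht : Tendsto (fun η : RelaxedControl T W => η.moments n)
        (comap RelaxedControl.moments (𝓝 ξ.moments)) (𝓝 (ξ.moments n)) :=
      ((continuous_apply n).tendsto ξ.moments).comp tendsto_comap
    filter_upwards [Metric.tendsto_nhds.1 ht (ε / 3) (by positivity)] with η hη
    have h₁ := (η.abs_integral_sub_le f.toContinuousMap
      (TopologicalSpace.denseSeq C(Time T × W, ℝ) n)).trans hsmall
    have h₂ := (ξ.abs_integral_sub_le f.toContinuousMap
      (TopologicalSpace.denseSeq C(Time T × W, ℝ) n)).trans hsmall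
    rw [Real.dist_eq] at hη ⊢
    rw [abs_le] at h₁ h₂
    rw [abs_lt] at hη ⊢
    simp only [RelaxedControl.moments] at hη
    simp only [RelaxedControl.toFiniteMeasure]
    simp only [BoundedContinuousFunction.coe_toContinuousMap] at h₁ h₂
    constructor <;> linarith [h₁.1, h₁.2, h₂.1, h₂.2, hη.1, hη.2]

instance RelaxedControl.instT2Space : T2Space (RelaxedControl T W) :=
  RelaxedControl.isEmbedding_toFiniteMeasure.t2Space

instance RelaxedControl.instSecondCountableTopology :
    SecondCountableTopology (RelaxedControl T W) :=
  RelaxedControl.isInducing_moments.secondCountableTopology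

theorem RelaxedControl.measurable_of_integral {X : Type*} [MeasurableSpace X]
    {F : X → RelaxedControl T W}
    (hF : ∀ g : C(Time T × W, ℝ),
      Measurable fun x => ∫ p, g p ∂((F x).1 : Measure (Time T × W))) : Measurable F := by
  have h : instMeasurableSpaceRelaxedControl T W =
      MeasurableSpace.comap RelaxedControl.moments inferInstance := by
    rw [BorelSpace.measurable_eq (α := ℕ → ℝ), ← borel_comap,
      ← RelaxedControl.isInducing_moments.eq_induced]
    rfl
  rw [h]
  exact measurable_comap_iff.2 (measurable_pi_lambda _ fun n => hF _)

/-- The relaxed control with the disintegration `k`. -/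
def relaxedOfKernel (k : Kernel (Time T) W) [IsMarkovKernel k] : RelaxedControl T W :=
  ⟨⟨(lebTime T) ⊗ₘ k, inferInstance⟩, Measure.fst_compProd _ _⟩

theorem cond_relaxedOfKernel [Nonempty W] (k : Kernel (Time T) W) [IsMarkovKernel k] :
    ∀ᵐ t ∂(lebTime T), (relaxedOfKernel k).cond t = k t := by
  have hfst : ((lebTime T) ⊗ₘ k).fst = lebTime T := Measure.fst_compProd _ _
  have h := eq_condKernel_of_measure_eq_compProd (ρ := (lebTime T) ⊗ₘ k) k (by rw [hfst])
  rw [hfst] at h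
  filter_upwards [h] with t ht
  exact ht.symm

theorem cond_constControl [Nonempty W] (w : W) :
    ∀ᵐ t ∂(lebTime T), (constControl w : RelaxedControl T W).cond t = Measure.dirac w := by
  have h : (constControl w : RelaxedControl T W) =
      relaxedOfKernel (Kernel.const _ (Measure.dirac w)) :=
    Subtype.ext (Subtype.ext Measure.compProd_const.symm)
  rw [h]
  filter_upwards [cond_relaxedOfKernel (T := T) (Kernel.const _ (Measure.dirac w))] with t ht
  rw [ht, Kernel.const_apply]

instance RelaxedControl.isProbabilityMeasure_cond [Nonempty W] (ξ : RelaxedControl T W)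
    (t : Time T) : IsProbabilityMeasure (ξ.cond t) := by
  unfold RelaxedControl.cond
  infer_instance

theorem lebTime_univ : lebTime T univ = ENNReal.ofReal T := by
  have he' : MeasurableEmbedding (fun t : Time T => (t : ℝ)) :=
    MeasurableEmbedding.subtype_coe measurableSet_Icc
  rw [lebTime, he'.comap_apply, image_univ, Subtype.range_coe, Real.volume_Icc, sub_zero]

/-- Injectivity needs `0 < T`: the mass of `univ ×ˢ {u}` separates the controls. The embedding lets
`u` be recovered measurably from its constant control. -/
theorem measurableEmbedding_constControl (hT : 0 < T) :
    MeasurableEmbedding (constControl : W → RelaxedControl T W) := by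
  refine (continuous_constControl.isClosedEmbedding fun u v huv => ?_).measurableEmbedding
  by_contra hne
  have h : ((lebTime T).prod (Measure.dirac u)) = (lebTime T).prod (Measure.dirac v) :=
    congr_arg (fun ξ : RelaxedControl T W => (ξ.1 : Measure (Time T × W))) huv
  have h' := congr_arg (fun μ : Measure (Time T × W) => μ (univ ×ˢ {u})) h
  simp [Measure.prod_prod, lebTime_univ, Ne.symm hne, hT.not_ge] at h'

end RelaxedControls

/-! ### Motions under relaxed controls -/

section Wasserstein

/-- The diagonal coupling costs nothing. At equal measures the hypothesis on `f` thus reduces to a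
Lipschitz bound in the state. -/
theorem wasserstein2_self {X : Type*} [PseudoMetricSpace X] [MeasurableSpace X]
    [OpensMeasurableSpace X] [SecondCountableTopology X] (μ : ProbabilityMeasure X) :
    wasserstein2 μ μ = 0 := by
  have hm : Measurable fun x : X => (x, x) := measurable_id.prodMk measurable_id
  have h : (⨅ π ∈ {π : ProbabilityMeasure (X × X) |
      (π : Measure (X × X)).map Prod.fst = μ ∧ (π : Measure (X × X)).map Prod.snd = μ},
      ∫⁻ p, edist p.1 p.2 ^ 2 ∂(π : Measure (X × X))) = 0 := by
    refine le_antisymm ?_ zero_le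
    refine (iInf₂_le (μ.map hm.aemeasurable) ⟨?_, ?_⟩).trans_eq ?_
    · rw [ProbabilityMeasure.toMeasure_map, lintegral_map (by fun_prop) hm]
      simp
    · rw [ProbabilityMeasure.toMeasure_map, Measure.map_map measurable_fst hm]
      exact Measure.map_id
    · rw [ProbabilityMeasure.toMeasure_map, Measure.map_map measurable_snd hm]
      exact Measure.map_id
  rw [wasserstein2, h]
  simp

end Wasserstein

/-! ### Continuity of the flow and the velocity field along it -/

section Flows

variable {d : ℕ} {T : ℝ} {s r : Time T} {m : Icc s r → ProbabilityMeasure (Torus d)}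

/-- The controlled velocity fields that are continuous, bounded by `M`, and `L`-Lipschitz in the
state. -/
structure IsAdmissible {d : ℕ} {T : ℝ} {U V : Type*} [TopologicalSpace U] [TopologicalSpace V]
    {s r : Time T} (g : Icc s r → Torus d → U → V → Vel d) (M L : ℝ) : Prop where
  continuous : Continuous fun p : Icc s r × Torus d × U × V => g p.1 p.2.1 p.2.2.1 p.2.2.2
  norm_le : ∀ t y u v, ‖g t y u v‖ ≤ M
  lipschitz : ∀ t y z u v, ‖g t y u v - g t z u v‖ ≤ L * dist y z
  nonneg : 0 ≤ L

/-- Paths are continuous in time, so dominated convergence applies to the integral of each bounded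
continuous test function. -/
theorem continuous_flow_of_eq_map {Ω : Type*} [MeasurableSpace Ω] {μ : Measure Ω}
    [IsProbabilityMeasure μ] {X : Ω → Path d s r} (hX : Measurable X)
    (hm : ∀ t, (m t : Measure (Torus d)) = μ.map (fun a => X a t)) : Continuous m := by
  refine continuous_iff_continuousAt.2 fun t => ?_
  refine ProbabilityMeasure.tendsto_iff_forall_integral_tendsto.2 fun k => ?_
  have hXt : ∀ t, Measurable fun a => X a t := fun t =>
    (continuous_eval_const t).measurable.comp hX
  have hk : ∀ t, ∫ y, k y ∂(m t : Measure (Torus d)) = ∫ a, k (X a t) ∂μ := fun t => by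
    rw [hm, integral_map (hXt t).aemeasurable k.continuous.aestronglyMeasurable]
  simp only [hk]
  refine tendsto_integral_filter_of_dominated_convergence (fun _ => ‖k‖) (.of_forall fun t' => ?_)
    (.of_forall fun t' => .of_forall fun a => k.norm_coe_le_norm _) (integrable_const _)
    (.of_forall fun a => ?_)
  · exact (k.continuous.measurable.comp (hXt t')).aestronglyMeasurable
  · exact (k.continuous.comp (X a).continuous).tendsto t

theorem exists_isAdmissible {U V : Type*} [TopologicalSpace U] [CompactSpace U]
    [TopologicalSpace V] [CompactSpace V]
    {f : Time T → Torus d → ProbabilityMeasure (Torus d) → U → V → Vel d}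
    (hf : Continuous
      fun p : Time T × Torus d × ProbabilityMeasure (Torus d) × U × V =>
        f p.1 p.2.1 p.2.2.1 p.2.2.2.1 p.2.2.2.2)
    (hLip : ∃ L : ℝ, 0 < L ∧ ∀ (t : Time T) (x' x'' : Torus d)
      (m' m'' : ProbabilityMeasure (Torus d)) (u : U) (v : V),
      ‖f t x' m' u v - f t x'' m'' u v‖ ≤ L * (dist x' x'' + wasserstein2 m' m''))
    (hm : Continuous m) :
    ∃ M L, IsAdmissible (fun t y u v => f (t : Icc s r) y (m t) u v) M L := by
  obtain ⟨L, hL, hLip⟩ := hLip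
  have hc : Continuous fun p : Icc s r × Torus d × U × V =>
      f p.1 p.2.1 (m p.1) p.2.2.1 p.2.2.2 :=
    hf.comp (by fun_prop : Continuous fun p : Icc s r × Torus d × U × V =>
      ((p.1 : Time T), p.2.1, m p.1, p.2.2.1, p.2.2.2))
  obtain ⟨M, hM⟩ := isCompact_univ.exists_bound_of_continuousOn hc.continuousOn
  exact ⟨M, L, hc, fun t y u v => hM (t, y, u, v) trivial,
    fun t y z u v => by simpa [wasserstein2_self] using hLip t y z (m t) (m t) u v, hL.le⟩

theorem IsAdmissible.isClosed_F₁ {U V : Type*} [TopologicalSpace U]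
    [TopologicalSpace V] [CompactSpace V] [Nonempty V]
    {f : Time T → Torus d → ProbabilityMeasure (Torus d) → U → V → Vel d} {M L : ℝ}
    (h : IsAdmissible (fun t y u v => f (t : Icc s r) y (m t) u v) M L)
    (t : Icc s r) (y : Torus d) (u : U) : IsClosed (F₁ f t y (m t) u) :=
  (isCompact_convexHull_range (g := fun v => f t y (m t) u v) (h.continuous.comp
    (by fun_prop : Continuous fun v : V => (t, y, u, v)))).isClosed

end Flows

section Motions

variable {d : ℕ} {T : ℝ} {U V : Type*}
  [MetricSpace U] [CompactSpace U] [MeasurableSpace U] [BorelSpace U]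
  [MetricSpace V] [CompactSpace V] [MeasurableSpace V] [BorelSpace V]
  {s r : Time T}

variable {g : Icc s r → Torus d → U → V → Vel d} {M L : ℝ}

theorem IsAdmissible.integral_integral (h : IsAdmissible g M L) (t : Icc s r) (y : Torus d)
    (μ : Measure U) (ν : Measure V) [IsProbabilityMeasure μ] [IsProbabilityMeasure ν] :
    ∫ u, ∫ v, g t y u v ∂ν ∂μ = ∫ p, g t y p.1 p.2 ∂(μ.prod ν) := by
  have hc : Continuous fun p : U × V => g t y p.1 p.2 :=
    h.continuous.comp (by fun_prop : Continuous fun p : U × V => (t, y, p.1, p.2))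
  rw [integral_prod _ (.of_bound hc.aestronglyMeasurable M (.of_forall fun p => h.norm_le _ _ _ _))]

variable [Nonempty U] [Nonempty V]

/-- The velocity field that is generated by a pair of relaxed controls. -/
def relaxedField (g : Icc s r → Torus d → U → V → Vel d) (ξ : RelaxedControl T U)
    (ζ : RelaxedControl T V) (t : Icc s r) (y : Torus d) : Vel d :=
  ∫ u, ∫ v, g t y u v ∂(ζ.cond t) ∂(ξ.cond t)

theorem IsAdmissible.isCaratheodory (h : IsAdmissible g M L) (ξ : RelaxedControl T U)
    (ζ : RelaxedControl T V) : IsCaratheodory (relaxedField g ξ ζ) M L where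
  aestronglyMeasurable x := by
    let K₁ : Kernel (Icc s r) U :=
      (ξ.1 : Measure (Time T × U)).condKernel.comap Subtype.val measurable_subtype_coe
    let K₂ : Kernel (Icc s r × U) V :=
      (ζ.1 : Measure (Time T × V)).condKernel.comap (fun p => (p.1 : Time T))
        (measurable_subtype_coe.comp measurable_fst)
    have hc : Continuous fun p : (Icc s r × U) × V => g p.1.1 (x p.1.1) p.1.2 p.2 :=
      h.continuous.comp (by fun_prop :
        Continuous fun p : (Icc s r × U) × V => (p.1.1, x p.1.1, p.1.2, p.2))
    have h₁ := hc.stronglyMeasurable.integral_kernel_prod_right' (κ := K₂)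
    exact (h₁.integral_kernel_prod_right' (κ := K₁)).aestronglyMeasurable
  norm_le t y := by
    rw [relaxedField, h.integral_integral]
    exact (norm_integral_le_of_norm_le_const (.of_forall fun p => h.norm_le _ _ _ _)).trans_eq
      (by simp)
  lipschitz t y z := by
    rw [relaxedField, relaxedField, h.integral_integral, h.integral_integral, ← integral_sub]
    · exact (norm_integral_le_of_norm_le_const
        (.of_forall fun p => h.lipschitz _ _ _ _ _)).trans_eq (by simp)
    all_goals
      refine .of_bound (Continuous.aestronglyMeasurable ?_) M (.of_forall fun p => h.norm_le _ _ _ _)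
      exact h.continuous.comp (by fun_prop :
        Continuous fun p : U × V => (t, _, p.1, p.2))
  nonneg := h.nonneg

theorem relaxedField_of_cond_eq_dirac {ξ : RelaxedControl T U} {ζ : RelaxedControl T V}
    {t : Icc s r} {u : U}
    (hu : ξ.cond t = Measure.dirac u) (y : Torus d) :
    relaxedField g ξ ζ t y = ∫ v, g t y u v ∂(ζ.cond t) := by
  rw [relaxedField, hu, integral_dirac]

variable {f : Time T → Torus d → ProbabilityMeasure (Torus d) → U → V → Vel d}
  {m : Icc s r → ProbabilityMeasure (Torus d)} (hsr : s < r)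

theorem IsAdmissible.existsUnique_isMotion
    (h : IsAdmissible (fun t y u v => f (t : Icc s r) y (m t) u v) M L) (y : Torus d)
    (ξ : RelaxedControl T U) (ζ : RelaxedControl T V) :
    ∃! x, IsMotion f hsr m y ξ ζ x := by
  obtain ⟨x, hx, hux⟩ := existsUnique_picard_fixed hsr (h.isCaratheodory ξ ζ) y
  exact ⟨x, ⟨(h.isCaratheodory ξ ζ).integrable x, hx⟩, fun z hz => hux z hz.2⟩

theorem IsAdmissible.isMotion_traj
    (h : IsAdmissible (fun t y u v => f (t : Icc s r) y (m t) u v) M L)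
    (p : Torus d × RelaxedControl T U × RelaxedControl T V) :
    IsMotion f hsr m p.1 p.2.1 p.2.2 (traj f hsr m p) := by
  have hex := (h.existsUnique_isMotion hsr p.1 p.2.1 p.2.2).exists
  rw [traj, dif_pos hex]
  exact hex.choose_spec

theorem IsAdmissible.traj_eq
    (h : IsAdmissible (fun t y u v => f (t : Icc s r) y (m t) u v) M L)
    {p : Torus d × RelaxedControl T U × RelaxedControl T V} {x : Path d s r}
    (hx : IsMotion f hsr m p.1 p.2.1 p.2.2 x) : traj f hsr m p = x :=
  (h.existsUnique_isMotion hsr p.1 p.2.1 p.2.2).unique (h.isMotion_traj hsr p) hx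

end Motions

/-! ### From distributions of controls to distributions of paths -/

section PathDistribution

variable {d : ℕ} {T : ℝ} {U V : Type*}
  [MetricSpace U] [CompactSpace U] [Nonempty U] [MeasurableSpace U] [BorelSpace U]
  [MetricSpace V] [CompactSpace V] [Nonempty V] [MeasurableSpace V] [BorelSpace V]
  {f : Time T → Torus d → ProbabilityMeasure (Torus d) → U → V → Vel d}
  {s r : Time T} {m : Icc s r → ProbabilityMeasure (Torus d)} {M L : ℝ} (hsr : s < r)

theorem IsMotion.apply_startPt {y : Torus d} {ξ : RelaxedControl T U} {ζ : RelaxedControl T V}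
    {x : Path d s r} (hx : IsMotion f hsr m y ξ ζ x) : x (startPt hsr) = y := by
  rw [hx.2, setIntegral_lebSub_clampTime hsr _ le_rfl, intervalIntegral.integral_same,
    toTorus_zero, add_zero]

/-- The velocity itself is the required selection: a constant control disintegrates into Dirac
masses, leaving an average over `V`, which stays in a closed convex set containing the values. -/
theorem IsAdmissible.sub_mem_of_isMotion
    (h : IsAdmissible (fun t y u v => f (t : Icc s r) y (m t) u v) M L)
    {y : Torus d} {u : U} {ζ : RelaxedControl T V} {x : Path d s r}
    (hx : IsMotion f hsr m y (constControl u) ζ x) {a b : Icc s r} (hab : a ≤ b) :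
    x b - x a ∈ toTorus '' setIntegral ((lebSub s r).restrict (Icc a b))
      (fun t => F₁ f t (x t) (m t) u) := by
  refine ⟨_, ⟨relaxedVelocity f m (constControl u) ζ x, hx.1.restrict, ae_restrict_of_ae ?_, rfl⟩,
    ?_⟩
  · filter_upwards [ae_lebSub_of_ae_lebTime (cond_constControl (T := T) u)] with t ht
    have hc : Continuous fun v => f t (x t) (m t) u v :=
      h.continuous.comp (by fun_prop : Continuous fun v : V => (t, x t, u, v))
    change relaxedField (fun t y u v => f (t : Icc s r) y (m t) u v) _ ζ t (x t) ∈ _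
    rw [relaxedField_of_cond_eq_dirac ht]
    exact (convex_convexHull ℝ _).integral_mem (h.isClosed_F₁ t (x t) u)
      (.of_forall fun v => subset_convexHull ℝ _ (mem_range_self v))
      (.of_bound hc.aestronglyMeasurable M (.of_forall fun v => h.norm_le _ _ _ _))
  · rw [← primitive_sub_primitive hsr hx.1 hab, toTorus_sub, hx.2 b, hx.2 a, add_sub_add_left_eq_sub]

theorem exists_pathDistribution_of_isProducedBy
    (hf : Continuous
      fun p : Time T × Torus d × ProbabilityMeasure (Torus d) × U × V =>
        f p.1 p.2.1 p.2.2.1 p.2.2.2.1 p.2.2.2.2)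
    (hLip : ∃ L : ℝ, 0 < L ∧ ∀ (t : Time T) (x' x'' : Torus d)
      (m' m'' : ProbabilityMeasure (Torus d)) (u : U) (v : V),
      ‖f t x' m' u v - f t x'' m'' u v‖ ≤ L * (dist x' x'' + wasserstein2 m' m''))
    {mstar : ProbabilityMeasure (Torus d)} {α : ProbabilityMeasure (Torus d × U)}
    {κ : ProbabilityMeasure (Torus d × RelaxedControl T U × RelaxedControl T V)}
    (hκ : κ ∈ consistentPairs V mstar (toRelaxed (T := T) α))
    (hm : IsProducedBy f hsr mstar κ m) :
    ∃ ν : ProbabilityMeasure (Path d s r × U),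
      (ν : Measure (Path d s r × U)).map (fun a => (a.1 (startPt hsr), a.2)) = α ∧
      (∀ t : Icc s r, (ν : Measure (Path d s r × U)).map (fun a => a.1 t) = m t) ∧
      (∀ t' t'' : Icc s r, t' ≤ t'' →
        ∫⁻ a, Metric.infEDist (a.1 t'' - a.1 t')
          (toTorus '' setIntegral ((lebSub s r).restrict (Icc t' t''))
            (fun t => F₁ f t (a.1 t) (m t) a.2)) ∂(ν : Measure (Path d s r × U)) = 0) := by
  obtain ⟨χ, hχm, -, hτ, hχ⟩ := hm
  obtain ⟨M, L, h⟩ := exists_isAdmissible hf hLip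
    (continuous_flow_of_eq_map (X := fun x => x) measurable_id hχm)
  have hT : 0 < T := s.2.1.trans_lt (lt_of_lt_of_le hsr r.2.2)
  have hemb := measurableEmbedding_constControl (W := U) hT
  -- `sel` is a measurable left inverse of `constControl`.
  obtain ⟨sel, hsel, hselc⟩ := hemb.exists_measurable_extend measurable_id fun _ => ‹Nonempty U›
  have hψ : AEMeasurable (fun p => (traj f hsr m p, sel p.2.1))
      (κ : Measure (Torus d × RelaxedControl T U × RelaxedControl T V)) :=
    hτ.prodMk (hsel.comp (measurable_fst.comp measurable_snd)).aemeasurable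
  have heval : ∀ t : Icc s r, Measurable fun x : Path d s r => x t := fun t =>
    (continuous_eval_const t).measurable
  have heval' : ∀ t : Icc s r, Measurable fun a : Path d s r × U => a.1 t := fun t =>
    (heval t).comp measurable_fst
  have hstartm : Measurable fun a : Path d s r × U => (a.1 (startPt hsr), a.2) :=
    (heval' _).prodMk measurable_snd
  have hpair : Measurable fun p : Torus d × RelaxedControl T U × RelaxedControl T V =>
      (p.1, p.2.1) := by fun_prop
  have hid : Measurable fun p : Torus d × U => (p.1, (constControl p.2 : RelaxedControl T U)) :=
    measurable_fst.prodMk (hemb.measurable.comp measurable_snd)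
  have hα : (κ : Measure (Torus d × RelaxedControl T U × RelaxedControl T V)).map
      (fun p => (p.1, p.2.1)) = (α : Measure (Torus d × U)).map
        (fun p => (p.1, (constControl p.2 : RelaxedControl T U))) := hκ.2
  have hconst : ∀ᵐ p ∂(κ : Measure (Torus d × RelaxedControl T U × RelaxedControl T V)),
      p.2.1 ∈ range (constControl : U → RelaxedControl T U) := by
    have hms : MeasurableSet {q : Torus d × RelaxedControl T U |
        q.2 ∈ range (constControl : U → RelaxedControl T U)} :=
      measurable_snd hemb.measurableSet_range
    refine ae_of_ae_map (f := fun p : Torus d × RelaxedControl T U × RelaxedControl T V =>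
      (p.1, p.2.1)) hpair.aemeasurable (p := fun q => q.2 ∈ range constControl) ?_
    rw [hα, ae_map_iff hid.aemeasurable hms]
    exact .of_forall fun p => mem_range_self _
  refine ⟨κ.map hψ, ?_, fun t => ?_, fun t' t'' htt => ?_⟩
  · have hstart : ∀ p : Torus d × RelaxedControl T U × RelaxedControl T V,
        traj f hsr m p (startPt hsr) = p.1 := fun p => (h.isMotion_traj hsr p).apply_startPt hsr
    rw [ProbabilityMeasure.toMeasure_map, AEMeasurable.map_map_of_aemeasurable
      hstartm.aemeasurable hψ]
    have : ((fun a : Path d s r × U => (a.1 (startPt hsr), a.2)) ∘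
        fun p => (traj f hsr m p, sel p.2.1)) =
        (fun q : Torus d × RelaxedControl T U => (q.1, sel q.2)) ∘ fun p => (p.1, p.2.1) := by
      ext1 p
      simp only [Function.comp_apply, hstart]
    rw [this, ← Measure.map_map (by fun_prop) hpair, hα, Measure.map_map (by fun_prop) hid]
    convert Measure.map_id
    ext1 p
    exact Prod.ext rfl (congr_fun hselc p.2)
  · rw [ProbabilityMeasure.toMeasure_map, AEMeasurable.map_map_of_aemeasurable
      (heval' t).aemeasurable hψ, hχm t, hχ,
      AEMeasurable.map_map_of_aemeasurable (heval t).aemeasurable hτ]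
    rfl
  · refine le_antisymm ?_ zero_le
    rw [ProbabilityMeasure.toMeasure_map]
    -- The inequality needs no measurability of the distance, and it suffices because the right-hand
    -- side is zero.
    refine (lintegral_map_le _ _).trans_eq ?_
    rw [← lintegral_zero (μ := (κ : Measure (Torus d × RelaxedControl T U × RelaxedControl T V)))]
    refine lintegral_congr_ae ?_
    filter_upwards [hconst] with p hp
    obtain ⟨u, hu⟩ := hp
    have hmot := h.isMotion_traj hsr p
    rw [← hu] at hmot
    have hsu : sel p.2.1 = u := by rw [← hu]; exact congr_fun hselc u
    rw [hsu]
    exact Metric.infEDist_zero_of_mem (h.sub_mem_of_isMotion hsr hmot htt)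

end PathDistribution

/-! ### Velocities of paths -/

section Lift

variable {d : ℕ}

/-- Cut `[a, b]` into pieces on which `y` moves by at most 1/4, lift the increment over each piece
by `rep`, which is an isometry at that scale, and add the lifts. -/
theorem exists_lipschitzWith_lift {K : NNReal} {y : ℝ → Torus d} (hy : LipschitzWith K y)
    {a b : ℝ} (hab : a ≤ b) :
    ∃ (K' : NNReal) (X : ℝ → Vel d), LipschitzWith K' X ∧
      ∀ t ∈ Icc a b, toTorus (X t) = y t - y a := by
  obtain ⟨N, hN⟩ := exists_nat_gt (4 * (K * (b - a)))
  have hKab : (0 : ℝ) ≤ K * (b - a) := mul_nonneg K.2 (sub_nonneg.2 hab)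
  have hN0 : (0 : ℝ) < N := lt_of_le_of_lt (by linarith) hN
  let c : ℕ → ℝ := fun k => a + k * ((b - a) / N)
  have hcs : ∀ k, c (k + 1) - c k = (b - a) / N := fun k => by
    simp only [c]
    push_cast
    ring
  -- The increment over the `k`th piece, stopped at time `t`: zero before the piece and constant
  -- after it. The sum telescopes.
  let z : ℕ → ℝ → Torus d := fun k t => y (min (c (k + 1)) t) - y (min (c k) t)
  have hz : ∀ k t, ‖z k t‖ ≤ 1 / 4 := fun k t => by
    rw [← dist_eq_norm]
    refine (hy.dist_le_mul _ _).trans ?_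
    have h₁ : dist (min (c (k + 1)) t) (min (c k) t) ≤ (b - a) / N := by
      rw [← hcs k, Real.dist_eq]
      refine (abs_min_sub_min_le_max _ _ _ _).trans ?_
      rw [sub_self, abs_zero, abs_of_nonneg (by rw [hcs]; exact div_nonneg (sub_nonneg.2 hab) hN0.le)]
      exact max_le le_rfl (by rw [hcs]; exact div_nonneg (sub_nonneg.2 hab) hN0.le)
    calc _ ≤ (K : ℝ) * ((b - a) / N) := by gcongr
      _ ≤ 1 / 4 := by
        rw [← mul_div_assoc, div_le_iff₀ hN0]
        linarith
  have hmin : ∀ k, LipschitzWith K fun t => y (min (c k) t) := fun k => by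
    simpa [Function.comp_def] using hy.comp ((LipschitzWith.id (α := ℝ)).const_min (c k))
  have hzl : ∀ k, LipschitzWith (K + K) fun t => rep (z k t) := fun k =>
    LipschitzWith.of_dist_le_mul fun t t' => by
      rw [dist_eq_norm, norm_rep_sub_rep (hz k t) (hz k t'), ← dist_eq_norm]
      exact ((hmin (k + 1)).sub (hmin k)).dist_le_mul t t'
  refine ⟨∑ k ∈ Finset.range N, (K + K), fun t => ∑ k ∈ Finset.range N, rep (z k t), ?_, ?_⟩
  · refine LipschitzWith.of_dist_le_mul fun t t' => ?_
    rw [NNReal.coe_sum, Finset.sum_mul]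
    exact dist_sum_sum_le_of_le _ fun k _ => (hzl k).dist_le_mul t t'
  · intro t ht
    have hsum : ∀ n, toTorus (∑ k ∈ Finset.range n, rep (z k t)) =
        y (min (c n) t) - y (min (c 0) t) := fun n => by
      rw [← Finset.sum_range_sub (fun k => y (min (c k) t))]
      induction n with
      | zero => simp
      | succ n ih => rw [Finset.sum_range_succ, toTorus_add, ih, Finset.sum_range_succ, toTorus_rep]
    have h0 : c 0 = a := by simp [c]
    have h1 : c N = b := by
      simp only [c]
      field_simp
      ring
    rw [hsum, h0, h1, min_eq_right ht.2, min_eq_left ht.1]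

/-- Each coordinate is Lipschitz, hence absolutely continuous. Rademacher's theorem identifies the
coordinate derivatives with the coordinates of the derivative. -/
theorem integral_deriv_eq_sub_of_lipschitzWith {K : NNReal} {X : ℝ → Vel d}
    (hX : LipschitzWith K X) (a b : ℝ) : ∫ t in a..b, deriv X t = X b - X a := by
  have hint : IntervalIntegrable (deriv X) volume a b := by
    rw [intervalIntegrable_iff]
    exact .of_bound (measure_Ioc_lt_top) (measurable_deriv X).aestronglyMeasurable K
      (.of_forall fun t => norm_deriv_le_of_lipschitz hX)
  ext i
  let p : Vel d →L[ℝ] ℝ := EuclideanSpace.proj i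
  have hp : ∀ v : Vel d, v i = p v := fun v => rfl
  rw [hp, ← p.intervalIntegral_comp_comm hint]
  have hac : AbsolutelyContinuousOnInterval (fun t => p (X t)) a b :=
    (p.lipschitz.comp hX).lipschitzOnWith.absolutelyContinuousOnInterval
  rw [PiLp.sub_apply, hp, hp, ← hac.integral_deriv_eq_sub]
  refine intervalIntegral.integral_congr_ae ?_
  filter_upwards [hX.ae_differentiableAt_real] with t ht _
  exact (p.hasFDerivAt.comp_hasDerivAt t ht.hasDerivAt).deriv.symm

end Lift

/-! ### Support functions of the velocity sets -/

section Support

variable {d : ℕ} {T : ℝ} {U V : Type*} [TopologicalSpace U] [TopologicalSpace V]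
  {s r : Time T} {g : Icc s r → Torus d → U → V → Vel d} {M L : ℝ}

/-- The support function of the set of the velocities `g t y u v`, `v ∈ V`. -/
def supportFn (g : Icc s r → Torus d → U → V → Vel d) (e : Vel d) (t : Icc s r) (y : Torus d)
    (u : U) : ℝ :=
  sSup ((fun v => inner ℝ e (g t y u v)) '' univ)

theorem IsAdmissible.continuous_supportFn [CompactSpace V] (h : IsAdmissible g M L) :
    Continuous fun q : Vel d × Icc s r × Torus d × U => supportFn g q.1 q.2.1 q.2.2.1 q.2.2.2 := by
  refine isCompact_univ.continuous_sSup
    (f := fun (q : Vel d × Icc s r × Torus d × U) v => inner ℝ q.1 (g q.2.1 q.2.2.1 q.2.2.2 v)) ?_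
  have := h.continuous.comp (by fun_prop : Continuous fun p : (Vel d × Icc s r × Torus d × U) × V =>
    (p.1.2.1, p.1.2.2.1, p.1.2.2.2, p.2))
  exact (continuous_fst.comp continuous_fst).inner this

theorem IsAdmissible.continuous_supportFn_comp [CompactSpace V] (h : IsAdmissible g M L)
    {X : Type*} [TopologicalSpace X] {e : X → Vel d} {t : X → Icc s r} {y : X → Torus d} {u : X → U}
    (he : Continuous e) (ht : Continuous t) (hy : Continuous y) (hu : Continuous u) :
    Continuous fun z => supportFn g (e z) (t z) (y z) (u z) :=
  h.continuous_supportFn.comp (he.prodMk (ht.prodMk (hy.prodMk hu)))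

theorem IsAdmissible.inner_le_supportFn (h : IsAdmissible g M L) (e : Vel d) (t : Icc s r)
    (y : Torus d) (u : U) {w : Vel d} (hw : w ∈ convexHull ℝ (range (g t y u))) :
    inner ℝ e w ≤ supportFn g e t y u := by
  have hbdd : BddAbove ((fun v => inner ℝ e (g t y u v)) '' univ) := by
    refine ⟨‖e‖ * M, ?_⟩
    rintro _ ⟨v, -, rfl⟩
    exact (real_inner_le_norm _ _).trans
      (mul_le_mul_of_nonneg_left (h.norm_le _ _ _ _) (norm_nonneg _))
  refine convexHull_min (t := {w | inner ℝ e w ≤ supportFn g e t y u}) ?_ ?_ hw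
  · rintro _ ⟨v, rfl⟩
    exact le_csSup hbdd ⟨v, trivial, rfl⟩
  · exact convex_halfSpace_le (innerₗ (Vel d) e).isLinear _

/-- The hull is compact, so Hahn–Banach would strictly separate an outside point in some direction,
against the inequality in that direction. -/
theorem IsAdmissible.mem_convexHull_of_forall_inner_le [CompactSpace V] [Nonempty V]
    (h : IsAdmissible g M L) (t : Icc s r)
    (y : Torus d) (u : U) {w : Vel d} (hw : ∀ e, inner ℝ e w ≤ supportFn g e t y u) :
    w ∈ convexHull ℝ (range (g t y u)) := by
  by_contra hn
  have hc : IsClosed (convexHull ℝ (range (g t y u))) :=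
    (isCompact_convexHull_range (h.continuous.comp
      (by fun_prop : Continuous fun v : V => (t, y, u, v)))).isClosed
  obtain ⟨φ, c, hφ, hcw⟩ := geometric_hahn_banach_closed_point (convex_convexHull ℝ _) hc hn
  have hφe : ∀ z, φ z = inner ℝ ((InnerProductSpace.toDual ℝ (Vel d)).symm φ) z := fun z =>
    (InnerProductSpace.toDual_symm_apply).symm
  refine (hcw.trans_le ((hφe w).trans_le (hw _))).not_ge (csSup_le (univ_nonempty.image _) ?_)
  rintro _ ⟨v, -, rfl⟩
  beta_reduce
  rw [← hφe]
  exact (hφ _ (subset_convexHull ℝ _ (mem_range_self v))).le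

theorem IsAdmissible.norm_le_of_mem_convexHull (h : IsAdmissible g M L) {t : Icc s r}
    {y : Torus d} {u : U} {w : Vel d} (hw : w ∈ convexHull ℝ (range (g t y u))) : ‖w‖ ≤ M := by
  have := convexHull_min (t := Metric.closedBall (0 : Vel d) M) (s := range (g t y u)) (by
    rintro _ ⟨v, rfl⟩
    simpa using h.norm_le t y u v) (convex_closedBall _ _) hw
  simpa using this

variable (x : Path d s r) (u : U) {a b : Icc s r} {w : Vel d}

theorem IsAdmissible.norm_le_of_mem_setIntegral (h : IsAdmissible g M L) (hab : a ≤ b)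
    (hw : w ∈ setIntegral ((lebSub s r).restrict (Icc a b))
      fun t => convexHull ℝ (range (g t (x t) u))) :
    ‖w‖ ≤ M * (((b : Time T) : ℝ) - ((a : Time T) : ℝ)) := by
  obtain ⟨k, hk, hkF, rfl⟩ := hw
  refine (norm_integral_le_of_norm_le_const (C := M) (hkF.mono fun t ht =>
    h.norm_le_of_mem_convexHull ht)).trans_eq ?_
  rw [measureReal_restrict_apply_univ, measureReal_def, lebSub_Icc, ENNReal.toReal_ofReal]
  exact sub_nonneg.2 hab

theorem IsAdmissible.inner_le_of_mem_setIntegral [CompactSpace V]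
    (h : IsAdmissible g M L) (e : Vel d)
    (hw : w ∈ setIntegral ((lebSub s r).restrict (Icc a b))
      fun t => convexHull ℝ (range (g t (x t) u))) :
    inner ℝ e w ≤ ∫ t in Icc a b, supportFn g e t (x t) u ∂(lebSub s r) := by
  obtain ⟨k, hk, hkF, rfl⟩ := hw
  rw [← integral_inner hk]
  refine integral_mono_ae (hk.const_inner e) ?_ (hkF.mono fun t ht => h.inner_le_supportFn e _ _ _ ht)
  have hc : Continuous fun t => supportFn g e t (x t) u :=
    h.continuous_supportFn_comp continuous_const continuous_id x.continuous continuous_const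
  exact hc.continuousOn.integrableOn_compact isClosed_Icc.isCompact

end Support

/-! ### Paths that satisfy the integral inclusion almost surely -/

section VelocityBounds

variable {d : ℕ} {T : ℝ} {s r : Time T}

/-- The path `x` is Lipschitz, and its displacements over short intervals are dominated, in the
directions `e n`, by the integrals of the support function of the set of velocities. -/
structure HasVelocityBounds {U V : Type*} (g : Icc s r → Torus d → U → V → Vel d) (M : ℝ)
    (e : ℕ → Vel d) (x : Path d s r) (u : U) : Prop where
  dist_le : ∀ a b : Icc s r, dist (x a) (x b) ≤ M * dist a b
  inner_le : ∀ (n : ℕ) (a b : Icc s r), a < b →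
    M * (((b : Time T) : ℝ) - ((a : Time T) : ℝ)) < 1 / 4 →
    inner ℝ (e n) (rep (x b - x a)) ≤
      ∫ t in Icc a b, supportFn g (e n) t (x t) u ∂(lebSub s r)

theorem dist_coe_of_le {a b : Icc s r} (h : a ≤ b) :
    dist a b = ((b : Time T) : ℝ) - ((a : Time T) : ℝ) := by
  rw [dist_comm]
  exact abs_of_nonneg (sub_nonneg.2 (show ((a : Time T) : ℝ) ≤ ((b : Time T) : ℝ) from h))

theorem continuousOn_rep : ContinuousOn (rep : Torus d → Vel d) (Metric.closedBall 0 (1 / 4)) := by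
  refine LipschitzOnWith.continuousOn (K := 1) (LipschitzOnWith.of_dist_le_mul fun z hz z' hz' => ?_)
  rw [mem_closedBall_zero_iff] at hz hz'
  rw [dist_eq_norm, dist_eq_norm, norm_rep_sub_rep hz hz', NNReal.coe_one, one_mul]

variable {U V : Type*} [TopologicalSpace U] [TopologicalSpace V] [CompactSpace V]
  {g : Icc s r → Torus d → U → V → Vel d} {M L : ℝ}

theorem IsAdmissible.integrable_supportFn (h : IsAdmissible g M L) (e : Vel d) (x : Path d s r)
    (u : U) : Integrable (fun t => supportFn g e t (x t) u) (lebSub s r) := by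
  have hc : Continuous fun t => supportFn g e t (x t) u :=
    h.continuous_supportFn_comp continuous_const continuous_id x.continuous continuous_const
  simpa using hc.continuousOn.integrableOn_compact (μ := lebSub s r) isCompact_univ

/-- It is enough to verify the velocity bounds between the points of a dense sequence. -/
theorem IsAdmissible.hasVelocityBounds_of_denseRange (hsr : s < r) (h : IsAdmissible g M L)
    {e : ℕ → Vel d} {x : Path d s r} {u : U} {q : ℕ → Icc s r} (hq : DenseRange q)
    (h₁ : ∀ i j, q i ≤ q j → ‖x (q j) - x (q i)‖ ≤
      M * (((q j : Time T) : ℝ) - ((q i : Time T) : ℝ)))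
    (h₂ : ∀ n i j, q i ≤ q j → M * (((q j : Time T) : ℝ) - ((q i : Time T) : ℝ)) < 1 / 4 →
      inner ℝ (e n) (rep (x (q j) - x (q i))) ≤
        ∫ t in Icc (q i) (q j), supportFn g (e n) t (x t) u ∂(lebSub s r)) :
    HasVelocityBounds g M e x u := by
  have hd : ∀ a b : Icc s r, dist (x a) (x b) ≤ M * dist a b := by
    refine fun a b => hq.induction_on₂ (p := fun a b => dist (x a) (x b) ≤ M * dist a b)
      (isClosed_le (by fun_prop) (by fun_prop)) (fun i j => ?_) a b
    rcases le_total (q i) (q j) with hij | hij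
    · rw [dist_comm, dist_eq_norm, dist_coe_of_le hij]
      exact h₁ i j hij
    · rw [dist_eq_norm, dist_comm, dist_coe_of_le hij]
      exact h₁ j i hij
  refine ⟨hd, fun n a b hab hM => ?_⟩
  -- A strict violation persists on an open set of pairs of times, and that set contains a pair from
  -- the dense sequence.
  by_contra! hlt
  have hint := h.integrable_supportFn (e n) x u
  let P : Icc s r → ℝ := fun b =>
    ∫ t in Icc (startPt hsr) b, supportFn g (e n) t (x t) u ∂(lebSub s r)
  have hP : Continuous P := continuous_primitive hsr hint
  -- On `O` the increments stay in the ball of radius 1/4, where `rep` is continuous.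
  let O : Set (Icc s r × Icc s r) :=
    {p | p.1 < p.2 ∧ M * (((p.2 : Time T) : ℝ) - ((p.1 : Time T) : ℝ)) < 1 / 4}
  have hO : IsOpen O :=
    (isOpen_lt continuous_fst continuous_snd).inter (isOpen_lt
      (f := fun p : Icc s r × Icc s r => M * (((p.2 : Time T) : ℝ) - ((p.1 : Time T) : ℝ)))
      (by fun_prop) continuous_const)
  have hΨ : ContinuousOn (fun p : Icc s r × Icc s r =>
      inner ℝ (e n) (rep (x p.2 - x p.1)) - (P p.2 - P p.1)) O := by
    refine ContinuousOn.sub (continuousOn_const.inner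
      (continuousOn_rep.comp (by fun_prop) fun p hp => ?_)) (by fun_prop)
    rw [mem_closedBall_zero_iff, ← dist_eq_norm, dist_comm]
    refine (hd _ _).trans ?_
    rw [dist_coe_of_le hp.1.le]
    exact hp.2.le
  have hopen := hΨ.isOpen_inter_preimage hO (isOpen_Ioi (a := (0 : ℝ)))
  obtain ⟨⟨i, j⟩, hij, hpos⟩ := (hq.prodMap hq).exists_mem_open hopen
    ⟨(a, b), ⟨hab, hM⟩, by
      simp only [mem_preimage, mem_Ioi, P]
      rw [primitive_sub_primitive hsr hint hab.le]
      linarith⟩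
  have hle : q i ≤ q j := hij.1.le
  have := h₂ n i j hle hij.2
  simp only [mem_preimage, mem_Ioi, P, Prod.map] at hpos
  rw [primitive_sub_primitive hsr hint hle] at hpos
  linarith

/-- Only the minorant `G` has to be measurable; this avoids proving that the distance `D` is. -/
theorem ae_nonpos_of_lintegral_eq_zero {Ω : Type*} [MeasurableSpace Ω] {μ : Measure Ω}
    {D : Ω → ℝ≥0∞} (hD : ∫⁻ a, D a ∂μ = 0) {G : Ω → ℝ} (hG : Measurable G)
    (hGD : ∀ᵐ a ∂μ, ENNReal.ofReal (G a) ≤ D a) : ∀ᵐ a ∂μ, G a ≤ 0 := by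
  have h0 : ∫⁻ a, ENNReal.ofReal (G a) ∂μ = 0 :=
    le_antisymm ((lintegral_mono_ae hGD).trans_eq hD) zero_le
  rw [lintegral_eq_zero_iff (by fun_prop)] at h0
  filter_upwards [h0] with a ha
  exact ENNReal.ofReal_eq_zero.1 ha

end VelocityBounds

section AlmostSure

variable {d : ℕ} {T : ℝ} {s r : Time T} {U V : Type*}
  [MetricSpace U] [CompactSpace U] [MeasurableSpace U] [BorelSpace U]
  [TopologicalSpace V] [CompactSpace V]
  {g : Icc s r → Torus d → U → V → Vel d} {M L : ℝ}

/-- The exceptional null set depends on the pair of times and the direction, so both range over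
countable families before the null sets are united. -/
theorem IsAdmissible.ae_hasVelocityBounds (hsr : s < r) (h : IsAdmissible g M L)
    (e : ℕ → Vel d) {ν : Measure (Path d s r × U)}
    (hν : ∀ a b : Icc s r, a ≤ b →
      ∫⁻ p, Metric.infEDist (p.1 b - p.1 a)
        (toTorus '' setIntegral ((lebSub s r).restrict (Icc a b))
          (fun t => convexHull ℝ (range (g t (p.1 t) p.2)))) ∂ν = 0) :
    ∀ᵐ p ∂ν, HasVelocityBounds g M e p.1 p.2 := by
  have : Nonempty (Icc s r) := ⟨startPt hsr⟩
  let q := TopologicalSpace.denseSeq (Icc s r)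
  have hdisp : ∀ a b : Icc s r, Measurable fun p : Path d s r × U => p.1 b - p.1 a :=
    fun a b => (((continuous_eval_const b).comp continuous_fst).sub
      ((continuous_eval_const a).comp continuous_fst)).measurable
  have h₁ : ∀ i j, q i ≤ q j → ∀ᵐ p ∂ν, ‖p.1 (q j) - p.1 (q i)‖ ≤
      M * (((q j : Time T) : ℝ) - ((q i : Time T) : ℝ)) := fun i j hij => by
    have := ae_nonpos_of_lintegral_eq_zero (hν _ _ hij)
      (G := fun p => ‖p.1 (q j) - p.1 (q i)‖ - M * (((q j : Time T) : ℝ) - ((q i : Time T) : ℝ)))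
      ((hdisp _ _).norm.sub_const _) (.of_forall fun p => ?_)
    · filter_upwards [this] with p hp using sub_nonpos.1 hp
    refine Metric.le_infEDist.2 ?_
    rintro _ ⟨w, hw, rfl⟩
    rw [edist_dist]
    refine ENNReal.ofReal_le_ofReal ?_
    have hw' := (norm_toTorus_le w).trans (h.norm_le_of_mem_setIntegral p.1 p.2 hij hw)
    rw [dist_eq_norm]
    linarith [norm_sub_norm_le (p.1 (q j) - p.1 (q i)) (toTorus w)]
  have h₂ : ∀ n i j, q i ≤ q j → M * (((q j : Time T) : ℝ) - ((q i : Time T) : ℝ)) < 1 / 4 →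
      ∀ᵐ p ∂ν, inner ℝ (e n) (rep (p.1 (q j) - p.1 (q i))) ≤
        ∫ t in Icc (q i) (q j), supportFn g (e n) t (p.1 t) p.2 ∂(lebSub s r) :=
    fun n i j hij hM => by
    have hsupp : Measurable fun p : Path d s r × U =>
        ∫ t in Icc (q i) (q j), supportFn g (e n) t (p.1 t) p.2 ∂(lebSub s r) := by
      have hc : Continuous fun p : (Path d s r × U) × Icc s r =>
          supportFn g (e n) p.2 (p.1.1 p.2) p.1.2 :=
        h.continuous_supportFn_comp continuous_const continuous_snd
          ((continuous_fst.comp continuous_fst).eval continuous_snd)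
          (continuous_snd.comp continuous_fst)
      exact hc.stronglyMeasurable.integral_prod_right'.measurable
    -- For `w` in the Aumann integral the numerator is at most `⟪e n, rep z - w⟫`, where `z` is the
    -- increment; by Cauchy–Schwarz the quotient is bounded by the distance. Adding 1 allows `e n =
    -- 0`.
    have := ae_nonpos_of_lintegral_eq_zero (hν _ _ hij)
      (G := fun p => (inner ℝ (e n) (rep (p.1 (q j) - p.1 (q i))) -
        ∫ t in Icc (q i) (q j), supportFn g (e n) t (p.1 t) p.2 ∂(lebSub s r)) / (‖e n‖ + 1))
      (((measurable_rep.comp (hdisp _ _)).const_inner.sub hsupp).div_const _) ?_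
    · filter_upwards [this] with p hp
      rw [div_le_iff₀ (by positivity), zero_mul] at hp
      exact sub_nonpos.1 hp
    · filter_upwards [h₁ i j hij] with p hp
      refine Metric.le_infEDist.2 ?_
      rintro _ ⟨w, hw, rfl⟩
      rw [edist_dist]
      refine ENNReal.ofReal_le_ofReal ?_
      have hw' := h.norm_le_of_mem_setIntegral p.1 p.2 hij hw
      set z := p.1 (q j) - p.1 (q i)
      -- Both vectors are shorter than 1/4, so the torus distance is the Euclidean one.
      have hdist : dist z (toTorus w) = ‖rep z - w‖ := by
        rw [← norm_toTorus, toTorus_sub, toTorus_rep, dist_eq_norm]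
        refine (norm_sub_le _ _).trans ?_
        rw [norm_rep]
        linarith
      rw [hdist, div_le_iff₀ (by positivity)]
      have h3 := h.inner_le_of_mem_setIntegral p.1 p.2 (e n) hw
      have h4 := real_inner_le_norm (e n) (rep z - w)
      rw [inner_sub_right] at h4
      nlinarith [norm_nonneg (rep z - w)]
  have h₁' := ae_all_iff.2 fun i => ae_all_iff.2 fun j => ae_all_iff.2 fun hij => h₁ i j hij
  have h₂' := ae_all_iff.2 fun n => ae_all_iff.2 fun i => ae_all_iff.2 fun j =>
    ae_all_iff.2 fun hij => ae_all_iff.2 fun hM => h₂ n i j hij hM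
  filter_upwards [h₁', h₂'] with p hp₁ hp₂
  exact h.hasVelocityBounds_of_denseRange hsr (TopologicalSpace.denseRange_denseSeq _) hp₁ hp₂

end AlmostSure

/-! ### The velocity of a path as a measurable function -/

section PathVelocity

variable {d : ℕ} {T : ℝ} {s r : Time T} (hsr : s < r)

theorem coe_clampTime_eq_max (x : ℝ) :
    ((clampTime hsr x : Time T) : ℝ) = max (s : ℝ) (min r x) := by
  have hsr' : (s : ℝ) ≤ r := hsr.le
  rcases le_total x s with h | h
  · have h₁ : clampTime hsr x ≤ clampTime hsr s := monotone_clampTime hsr h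
    have h₂ : clampTime hsr (s : ℝ) = startPt hsr := clampTime_coe hsr (startPt hsr)
    rw [le_antisymm (h₁.trans_eq h₂) (startPt_le hsr _), min_eq_right (h.trans hsr'),
      max_eq_left h]
    rfl
  · rcases le_total x r with h' | h'
    · rw [coe_clampTime hsr h h', min_eq_right h', max_eq_right h]
    · have h₁ : clampTime hsr r ≤ clampTime hsr x := monotone_clampTime hsr h'
      rw [min_eq_left h', max_eq_right hsr']
      refine le_antisymm (clampTime hsr x).2.2 ?_
      have h₂ : ((clampTime hsr r : Time T) : ℝ) ≤ ((clampTime hsr x : Time T) : ℝ) := h₁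
      rwa [coe_clampTime hsr hsr' le_rfl] at h₂

theorem lipschitzWith_clampTime : LipschitzWith 1 (clampTime hsr) :=
  LipschitzWith.of_dist_le_mul fun x y => by
    have h := ((LipschitzWith.id (α := ℝ)).const_min (r : ℝ)).const_max (s : ℝ)
    rw [Subtype.dist_eq, Subtype.dist_eq, coe_clampTime_eq_max, coe_clampTime_eq_max]
    exact h.dist_le_mul x y

/-- The right derivative of a path, computed along the steps `1 / (n + 1)`. -/
def pathVelocity (x : Path d s r) (t : Icc s r) : Vel d :=
  limUnder atTop fun n : ℕ => (1 / ((n : ℝ) + 1))⁻¹ •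
    rep (x (clampTime hsr (((t : Time T) : ℝ) + 1 / ((n : ℝ) + 1))) - x t)

/-- The velocity is a sequential limit of jointly Borel difference quotients, so no measurable
choice of a lift is needed. `limUnder` takes care of the times without a limit. -/
theorem measurable_pathVelocity :
    Measurable fun p : Path d s r × Icc s r => pathVelocity hsr p.1 p.2 := by
  refine (StronglyMeasurable.limUnder fun n => ?_).measurable
  have hc := continuous_clampTime hsr
  have h : Measurable fun p : Path d s r × Icc s r =>
      p.1 (clampTime hsr (((p.2 : Time T) : ℝ) + 1 / ((n : ℝ) + 1))) - p.1 p.2 :=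
    ((continuous_fst.eval (hc.comp ((continuous_coe_subinterval.comp continuous_snd).add
      continuous_const))).sub (continuous_fst.eval continuous_snd)).measurable
  exact ((measurable_rep.comp h).const_smul (1 / ((n : ℝ) + 1))⁻¹).stronglyMeasurable

variable {U V : Type*} [TopologicalSpace U] [TopologicalSpace V] [CompactSpace V]
  {g : Icc s r → Torus d → U → V → Vel d} {M L : ℝ}

theorem exists_lift_path {x : Path d s r} {M : ℝ}
    (hx : ∀ a b : Icc s r, dist (x a) (x b) ≤ M * dist a b) :
    ∃ (K : NNReal) (X : ℝ → Vel d), LipschitzWith K X ∧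
      ∀ t ∈ Icc (s : ℝ) r, toTorus (X t) = x (clampTime hsr t) - x (startPt hsr) := by
  have hx' : LipschitzWith M.toNNReal x := LipschitzWith.of_dist_le_mul fun a b =>
    (hx a b).trans (mul_le_mul_of_nonneg_right (Real.le_coe_toNNReal M) dist_nonneg)
  obtain ⟨K, X, hX, hXt⟩ := exists_lipschitzWith_lift (hx'.comp (lipschitzWith_clampTime hsr))
    (show (s : ℝ) ≤ r from hsr.le)
  refine ⟨K, X, hX, fun t ht => (hXt t ht).trans ?_⟩
  have h : clampTime hsr (s : ℝ) = startPt hsr := clampTime_coe hsr (startPt hsr)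
  rw [← h]
  rfl

/-- For small steps the increment of the lift is shorter than 1/4 and therefore equals the
representative of the increment of the path. -/
theorem tendsto_slope_rep {x : Path d s r} {X : ℝ → Vel d} {t : ℝ} {w : Vel d}
    (hX : ∀ t ∈ Icc (s : ℝ) r, toTorus (X t) = x (clampTime hsr t) - x (startPt hsr))
    (ht : t ∈ Ioo (s : ℝ) r) (hw : HasDerivAt X w t) :
    Tendsto (fun h : ℝ => h⁻¹ • rep (x (clampTime hsr (t + h)) - x (clampTime hsr t)))
      (𝓝[>] 0) (𝓝 w) := by
  refine hw.tendsto_slope_zero_right.congr' ?_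
  have h₁ : ∀ᶠ h : ℝ in 𝓝[>] 0, dist (X (t + h)) (X t) < 1 / 4 := by
    have : Tendsto (fun h : ℝ => X (t + h)) (𝓝 0) (𝓝 (X t)) := by
      have h := hw.continuousAt.tendsto.comp
        ((continuous_const_add t).tendsto' 0 t (add_zero t))
      exact h
    exact nhdsWithin_le_nhds (Metric.tendsto_nhds.1 this _ (by norm_num))
  have h₂ : ∀ᶠ h : ℝ in 𝓝[>] 0, h < r - t :=
    nhdsWithin_le_nhds (gt_mem_nhds (sub_pos.2 ht.2))
  filter_upwards [h₁, h₂, self_mem_nhdsWithin] with h hh₁ hh₂ hh₃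
  rw [mem_Ioi] at hh₃
  rw [dist_eq_norm] at hh₁
  rw [← rep_toTorus hh₁.le, toTorus_sub, hX _ ⟨by linarith [ht.1], by linarith⟩,
    hX _ ⟨ht.1.le, ht.2.le⟩, sub_sub_sub_cancel_right]

theorem pathVelocity_eq {x : Path d s r} {X : ℝ → Vel d} {t : ℝ} {w : Vel d}
    (hX : ∀ t ∈ Icc (s : ℝ) r, toTorus (X t) = x (clampTime hsr t) - x (startPt hsr))
    (ht : t ∈ Ioo (s : ℝ) r) (hw : HasDerivAt X w t) :
    pathVelocity hsr x (clampTime hsr t) = w := by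
  have h : Tendsto (fun n : ℕ => 1 / ((n : ℝ) + 1)) atTop (𝓝[>] 0) :=
    tendsto_nhdsWithin_iff.2 ⟨tendsto_one_div_add_atTop_nhds_zero_nat,
      .of_forall fun n => by simp only [mem_Ioi]; positivity⟩
  rw [pathVelocity, coe_clampTime hsr ht.1.le ht.2.le]
  exact ((tendsto_slope_rep hsr hX ht hw).comp h).limUnder_eq

/-- Divide the bound on displacements by the length of the interval and let it shrink; the support
function is continuous along the path. -/
theorem HasVelocityBounds.inner_le_supportFn (h : IsAdmissible g M L) {e : ℕ → Vel d}
    {x : Path d s r} {u : U} (hx : HasVelocityBounds g M e x u)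
    {X : ℝ → Vel d} {t : ℝ} {w : Vel d}
    (hX : ∀ t ∈ Icc (s : ℝ) r, toTorus (X t) = x (clampTime hsr t) - x (startPt hsr))
    (ht : t ∈ Ioo (s : ℝ) r) (hw : HasDerivAt X w t) (n : ℕ) :
    inner ℝ (e n) w ≤ supportFn g (e n) (clampTime hsr t) (x (clampTime hsr t)) u := by
  have hcc := continuous_clampTime hsr
  have hk : Continuous fun τ : ℝ =>
      supportFn g (e n) (clampTime hsr τ) (x (clampTime hsr τ)) u :=
    h.continuous_supportFn_comp continuous_const hcc (x.continuous.comp hcc) continuous_const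
  have hprim := ((hk.integral_hasStrictDerivAt t t).hasDerivAt).tendsto_slope_zero_right
  have hinner := (tendsto_const_nhds (x := e n)).inner (𝕜 := ℝ) (tendsto_slope_rep hsr hX ht hw)
  refine le_of_tendsto_of_tendsto hinner hprim ?_
  have h₂ : ∀ᶠ δ : ℝ in 𝓝[>] 0, δ < r - t :=
    nhdsWithin_le_nhds (gt_mem_nhds (sub_pos.2 ht.2))
  have h₃ : ∀ᶠ δ : ℝ in 𝓝[>] 0, M * δ < 1 / 4 :=
    nhdsWithin_le_nhds (((continuous_const_mul M).tendsto' 0 0 (mul_zero M)).eventually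
      (gt_mem_nhds (by norm_num)))
  filter_upwards [h₂, h₃, self_mem_nhdsWithin] with δ hδ₂ hδ₃ hδ
  rw [mem_Ioi] at hδ
  have hca := coe_clampTime hsr ht.1.le ht.2.le
  have hcb := coe_clampTime hsr (x := t + δ) (by linarith [ht.1]) (by linarith)
  have hlt : clampTime hsr t < clampTime hsr (t + δ) := by
    rw [← Subtype.coe_lt_coe, ← Subtype.coe_lt_coe, hca, hcb]
    linarith
  have hle := hx.inner_le n _ _ hlt (by rw [hca, hcb]; simpa using hδ₃)
  rw [setIntegral_lebSub_clampTime hsr (fun τ => supportFn g (e n) τ (x τ) u) hlt.le, hca, hcb]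
    at hle
  rw [inner_smul_right, intervalIntegral.integral_same, sub_zero, smul_eq_mul]
  exact mul_le_mul_of_nonneg_left hle (inv_nonneg.2 hδ.le)

theorem HasVelocityBounds.mem_convexHull [Nonempty V] (h : IsAdmissible g M L) {e : ℕ → Vel d}
    (he : DenseRange e) {x : Path d s r} {u : U} (hx : HasVelocityBounds g M e x u)
    {X : ℝ → Vel d} {t : ℝ} {w : Vel d}
    (hX : ∀ t ∈ Icc (s : ℝ) r, toTorus (X t) = x (clampTime hsr t) - x (startPt hsr))
    (ht : t ∈ Ioo (s : ℝ) r) (hw : HasDerivAt X w t) :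
    w ∈ convexHull ℝ (range (g (clampTime hsr t) (x (clampTime hsr t)) u)) := by
  refine h.mem_convexHull_of_forall_inner_le (clampTime hsr t) (x (clampTime hsr t)) u fun c => ?_
  have hcl : IsClosed {c | inner ℝ c w ≤
      supportFn g c (clampTime hsr t) (x (clampTime hsr t)) u} :=
    isClosed_le (continuous_id.inner continuous_const) (h.continuous_supportFn_comp
      continuous_id continuous_const continuous_const continuous_const)
  exact he.induction_on (p := fun c => inner ℝ c w ≤
    supportFn g c (clampTime hsr t) (x (clampTime hsr t)) u) c hcl
    fun n => hx.inner_le_supportFn hsr h hX ht hw n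

theorem HasVelocityBounds.isTrajectory [Nonempty V] (h : IsAdmissible g M L) {e : ℕ → Vel d}
    (he : DenseRange e) {x : Path d s r} {u : U} (hx : HasVelocityBounds g M e x u) :
    (∀ᵐ t ∂(lebSub s r), pathVelocity hsr x t ∈ convexHull ℝ (range (g t (x t) u))) ∧
      ∀ t, x t = x (startPt hsr) +
        toTorus (∫ τ in Icc (startPt hsr) t, pathVelocity hsr x τ ∂(lebSub s r)) := by
  obtain ⟨K, X, hXl, hX⟩ := exists_lift_path hsr hx.dist_le
  have hioo : ∀ᵐ t ∂(volume.restrict (Icc (s : ℝ) r)), t ∈ Ioo (s : ℝ) r := by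
    rw [← restrict_Ioo_eq_restrict_Icc]
    exact ae_restrict_mem measurableSet_Ioo
  have hae : ∀ᵐ t ∂(volume.restrict (Icc (s : ℝ) r)),
      t ∈ Ioo (s : ℝ) r ∧ HasDerivAt X (deriv X t) t := by
    filter_upwards [hioo, ae_restrict_of_ae hXl.ae_differentiableAt_real] with t ht₁ ht₂
    exact ⟨ht₁, ht₂.hasDerivAt⟩
  constructor
  · rw [ae_lebSub_iff hsr]
    filter_upwards [hae] with t ht
    rw [pathVelocity_eq hsr hX ht.1 ht.2]
    exact hx.mem_convexHull hsr h he hX ht.1 ht.2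
  · intro t
    have hst : (s : ℝ) ≤ ((t : Time T) : ℝ) := startPt_le hsr t
    have hint : ∫ τ in Icc (startPt hsr) t, pathVelocity hsr x τ ∂(lebSub s r) =
        ∫ τ in (s : ℝ)..((t : Time T) : ℝ), deriv X τ := by
      rw [setIntegral_lebSub_clampTime hsr _ (startPt_le hsr t)]
      change ∫ τ in (s : ℝ)..((t : Time T) : ℝ), _ = _
      rw [intervalIntegral.integral_of_le hst, intervalIntegral.integral_of_le hst]
      refine integral_congr_ae ?_
      filter_upwards [ae_restrict_of_ae_restrict_of_subset
        (Ioc_subset_Icc_self.trans (Icc_subset_Icc_right t.2.2)) hae] with τ hτ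
      exact pathVelocity_eq hsr hX hτ.1 hτ.2
    rw [hint, integral_deriv_eq_sub_of_lipschitzWith hXl, toTorus_sub, hX _ ⟨hst, t.2.2⟩,
      hX _ ⟨le_rfl, hsr.le⟩, clampTime_coe]
    have h : clampTime hsr (s : ℝ) = startPt hsr := clampTime_coe hsr (startPt hsr)
    rw [h]
    abel

end PathVelocity

/-! ### Realization of velocities by relaxed controls -/

section ComboMeasure

variable {V : Type*} [MetricSpace V] [CompactSpace V] [MeasurableSpace V] [BorelSpace V] {n : ℕ}

instance instNonemptyConvexParam [Nonempty V] : Nonempty (ConvexParam (n + 1) V) :=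
  ⟨⟨⟨Pi.single 0 1, single_mem_stdSimplex ℝ 0⟩, fun _ => Classical.arbitrary V⟩⟩

/-- The convex combination of Dirac measures with given parameters. -/
def comboMeasure (p : ConvexParam n V) : Measure V :=
  ∑ i, ENNReal.ofReal (p.1 i) • Measure.dirac (p.2 i)

theorem measurable_comboMeasure :
    Measurable (comboMeasure : ConvexParam n V → Measure V) := by
  refine Measure.measurable_of_measurable_coe _ fun A hA => ?_
  simp only [comboMeasure, Measure.coe_finsetSum, Finset.sum_apply, Measure.smul_apply,
    smul_eq_mul]
  refine Finset.measurable_fun_sum _ fun i _ => Measurable.mul ?_ ?_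
  · exact (((continuous_apply i).comp
      (continuous_subtype_val.comp continuous_fst)).measurable).ennreal_ofReal
  · exact (Measure.measurable_coe hA).comp
      (Measure.measurable_dirac.comp ((measurable_pi_apply i).comp measurable_snd))

instance instIsProbabilityMeasureComboMeasure (p : ConvexParam n V) :
    IsProbabilityMeasure (comboMeasure p) := by
  constructor
  simp only [comboMeasure, Measure.coe_finsetSum, Finset.sum_apply, Measure.smul_apply,
    smul_eq_mul, measure_univ, mul_one]
  rw [← ENNReal.ofReal_sum_of_nonneg fun i _ => show 0 ≤ p.1 i from p.1.2.1 i,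
    show ∑ i, p.1 i = 1 from p.1.2.2, ENNReal.ofReal_one]

theorem integral_comboMeasure {E : Type*} [NormedAddCommGroup E] [NormedSpace ℝ E]
    [CompleteSpace E] (p : ConvexParam n V) (k : V → E) :
    ∫ v, k v ∂(comboMeasure p) = convexCombo k p := by
  rw [comboMeasure, integral_finsetSum_measure fun i _ => ?_]
  · refine Finset.sum_congr rfl fun i _ => ?_
    rw [integral_smul_measure, integral_dirac, ENNReal.toReal_ofReal (show 0 ≤ p.1 i from p.1.2.1 i)]
  · exact (integrable_dirac (by simp)).smul_measure ENNReal.ofReal_ne_top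

/-- The combinations form a kernel on `X × Time T`. Fixing the first variable gives a
disintegration, and measurability is tested on integrals of continuous functions. -/
theorem exists_measurable_relaxedControl_cond_eq [Nonempty V] {T : ℝ} {X : Type*}
    [MeasurableSpace X] {θ : X × Time T → ConvexParam n V} (hθ : Measurable θ) :
    ∃ Z : X → RelaxedControl T V, Measurable Z ∧
      ∀ p, ∀ᵐ t ∂(lebTime T), (Z p).cond t = comboMeasure (θ (p, t)) := by
  let K : Kernel (X × Time T) V := ⟨fun q => comboMeasure (θ q), measurable_comboMeasure.comp hθ⟩
  have hK : IsMarkovKernel K := ⟨fun q => instIsProbabilityMeasureComboMeasure _⟩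
  let k : X → Kernel (Time T) V := fun p => K.comap (fun t => (p, t)) measurable_prodMk_left
  refine ⟨fun p => relaxedOfKernel (k p), RelaxedControl.measurable_of_integral fun φ => ?_,
    fun p => cond_relaxedOfKernel (k p)⟩
  have hint : ∀ p, ∫ q, φ q ∂((relaxedOfKernel (k p)).1 : Measure (Time T × V)) =
      ∫ t, ∫ v, φ (t, v) ∂(K (p, t)) ∂(lebTime T) := fun p =>
    Measure.integral_compProd ((BoundedContinuousFunction.mkOfCompact φ).integrable _)
  simp_rw [hint]
  have h₁ : StronglyMeasurable fun q : (X × Time T) × V => φ (q.1.2, q.2) :=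
    (φ.continuous.measurable.comp
      ((measurable_snd.comp measurable_fst).prodMk measurable_snd)).stronglyMeasurable
  exact (h₁.integral_kernel_prod_right' (κ := K)).integral_prod_right'.measurable

end ComboMeasure

/-! ### Measurable choice of the second player's control -/

section Realization

variable {d : ℕ} {T : ℝ} {s r : Time T} {U V : Type*}
  [MetricSpace U] [CompactSpace U] [MeasurableSpace U] [BorelSpace U]
  [MetricSpace V] [CompactSpace V] [Nonempty V] [MeasurableSpace V] [BorelSpace V]
  {g : Icc s r → Torus d → U → V → Vel d} {M L : ℝ}

theorem IsAdmissible.exists_measurable_convexParam (h : IsAdmissible g M L) :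
    ∃ σ : Icc s r × Torus d × U × Vel d →
        ConvexParam (Module.finrank ℝ (Vel d) + 1) V, Measurable σ ∧
      ∀ t y u w, w ∈ convexHull ℝ (range (g t y u)) →
        convexCombo (g t y u) (σ (t, y, u, w)) = w := by
  have hc : Continuous fun q : (Icc s r × Torus d × U × Vel d) × V => g q.1.1 q.1.2.1 q.1.2.2.1 q.2 :=
    h.continuous.comp ((continuous_fst.comp continuous_fst).prodMk
      ((continuous_fst.comp (continuous_snd.comp continuous_fst)).prodMk
        ((continuous_fst.comp (continuous_snd.comp (continuous_snd.comp continuous_fst))).prodMk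
          continuous_snd)))
  have hG : IsClosed {q : (Icc s r × Torus d × U × Vel d) ×
      ConvexParam (Module.finrank ℝ (Vel d) + 1) V |
        convexCombo (g q.1.1 q.1.2.1 q.1.2.2.1) q.2 = q.1.2.2.2} :=
    isClosed_eq (continuous_convexCombo
      (g := fun q : Icc s r × Torus d × U × Vel d => g q.1 q.2.1 q.2.2.1) hc)
      (continuous_snd.comp (continuous_snd.comp (continuous_snd.comp continuous_fst)))
  obtain ⟨σ, hσ, hσG⟩ := exists_measurable_selection hG
  exact ⟨σ, hσ, fun t y u w hw => hσG (t, y, u, w) (exists_convexCombo_eq _ hw)⟩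

/-- Measurably in the path `x` and the control `u`, there is a relaxed control of the second player
under which `x` moves with its velocity whenever this velocity is admissible. -/
theorem IsAdmissible.exists_measurable_relaxedControl (hsr : s < r) (h : IsAdmissible g M L) :
    ∃ Z : Path d s r × U → RelaxedControl T V, Measurable Z ∧
      ∀ p : Path d s r × U,
        (∀ᵐ t ∂(lebSub s r), pathVelocity hsr p.1 t ∈ convexHull ℝ (range (g t (p.1 t) p.2))) →
        ∀ᵐ t : Icc s r ∂(lebSub s r),
          ∫ v, g t (p.1 t) p.2 v ∂((Z p).cond t) = pathVelocity hsr p.1 t := by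
  obtain ⟨σ, hσ, hσg⟩ := h.exists_measurable_convexParam
  -- A relaxed control lives on all of `[0, T]`; outside `[s, r]` its values do not matter, so times
  -- are retracted onto `[s, r]`.
  obtain ⟨c, hc, hct⟩ : ∃ c : Time T → Icc s r, Measurable c ∧ ∀ t : Icc s r, c t = t :=
    ⟨projIcc s r hsr.le, continuous_projIcc.measurable, projIcc_val hsr.le⟩
  have heval : Measurable fun q : Path d s r × Icc s r => q.1 q.2 :=
    (continuous_fst.eval continuous_snd).measurable
  have h₁ : Measurable fun q : (Path d s r × U) × Time T => (q.1.1, c q.2) :=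
    (measurable_fst.comp measurable_fst).prodMk (hc.comp measurable_snd)
  have hvel : Measurable fun q : (Path d s r × U) × Time T => pathVelocity hsr q.1.1 (c q.2) := by
    have h₂ := (measurable_pathVelocity hsr).comp h₁
    exact h₂
  have hpos : Measurable fun q : (Path d s r × U) × Time T => q.1.1 (c q.2) := heval.comp h₁
  have hQ : Measurable fun q : (Path d s r × U) × Time T =>
      (c q.2, q.1.1 (c q.2), q.1.2, pathVelocity hsr q.1.1 (c q.2)) :=
    (hc.comp measurable_snd).prodMk
      (hpos.prodMk ((measurable_snd.comp measurable_fst).prodMk hvel))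
  obtain ⟨Z, hZ, hZc⟩ := exists_measurable_relaxedControl_cond_eq (hσ.comp hQ)
  refine ⟨Z, hZ, fun p hp => ?_⟩
  filter_upwards [hp, ae_lebSub_of_ae_lebTime (hZc p)] with t ht₁ ht₂
  rw [ht₂, integral_comboMeasure]
  simp only [Function.comp_apply, hct]
  exact hσg _ _ _ _ ht₁

end Realization

/-! ### From distributions of paths to distributions of controls -/

section ControlDistribution

/-- A function that is a left inverse, almost everywhere, of a measurable map between standard Borel
spaces is almost everywhere measurable with respect to the image measure. -/
theorem aemeasurable_map_of_ae_leftInverse {X Y Z : Type*} [MeasurableSpace X]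
    [StandardBorelSpace X] [MeasurableSpace Y] [MeasurableSpace.CountablySeparated Y]
    [MeasurableSpace Z] {μ : Measure X} {Φ : X → Y} (hΦ : Measurable Φ) {F : Y → Z} {G : X → Z}
    (hG : Measurable G) {S : Set X} (hS : ∀ᵐ p ∂μ, p ∈ S) (hinj : InjOn Φ S)
    (hF : ∀ p ∈ S, F (Φ p) = G p) : AEMeasurable F (μ.map Φ) := by
  -- `S` need not be measurable. Off a measurable null set containing its complement, `Φ` is
  -- injective between suitable Borel spaces, hence an embedding by Lusin–Souslin.
  obtain ⟨B, hSB, hB, hB0⟩ := exists_measurable_superset_of_null (mem_ae_iff.1 hS)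
  have hA : MeasurableSet Bᶜ := hB.compl
  have hAS : Bᶜ ⊆ S := compl_subset_comm.1 hSB
  have : StandardBorelSpace ↥Bᶜ := hA.standardBorel
  have hemb : MeasurableEmbedding (Φ ∘ ((↑) : ↥Bᶜ → X)) :=
    (hΦ.comp measurable_subtype_coe).measurableEmbedding fun p q hpq =>
      Subtype.ext (hinj (hAS p.2) (hAS q.2) hpq)
  have hμ : μ = (μ.comap ((↑) : ↥Bᶜ → X)).map (↑) := by
    rw [map_comap_subtype_coe hA]
    exact (Measure.restrict_eq_self_of_ae_mem (measure_eq_zero_iff_ae_notMem.1 hB0)).symm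
  rw [hμ, Measure.map_map hΦ measurable_subtype_coe, hemb.aemeasurable_map_iff]
  refine (hG.comp measurable_subtype_coe).aemeasurable.congr (.of_forall fun p => ?_)
  exact (hF p (hAS p.2)).symm

variable {d : ℕ} {T : ℝ} {U V : Type*}
  [MetricSpace U] [CompactSpace U] [Nonempty U] [MeasurableSpace U] [BorelSpace U]
  [MetricSpace V] [CompactSpace V] [Nonempty V] [MeasurableSpace V] [BorelSpace V]
  {f : Time T → Torus d → ProbabilityMeasure (Torus d) → U → V → Vel d}
  {s r : Time T} {m : Icc s r → ProbabilityMeasure (Torus d)} {M L : ℝ} (hsr : s < r)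

theorem IsAdmissible.isMotion_of_pathVelocity
    (h : IsAdmissible (fun t y u v => f (t : Icc s r) y (m t) u v) M L)
    {x : Path d s r} {u : U} {ζ : RelaxedControl T V}
    (hζ : ∀ᵐ t : Icc s r ∂(lebSub s r),
      ∫ v, f t (x t) (m t) u v ∂(ζ.cond t) = pathVelocity hsr x t)
    (hx : ∀ t, x t = x (startPt hsr) +
      toTorus (∫ τ in Icc (startPt hsr) t, pathVelocity hsr x τ ∂(lebSub s r))) :
    IsMotion f hsr m (x (startPt hsr)) (constControl u) ζ x := by
  have hae : ∀ᵐ t ∂(lebSub s r),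
      relaxedVelocity f m (constControl u) ζ x t = pathVelocity hsr x t := by
    filter_upwards [hζ, ae_lebSub_of_ae_lebTime (cond_constControl (T := T) u)] with t ht₁ ht₂
    rw [← ht₁]
    exact relaxedField_of_cond_eq_dirac
      (g := fun t y u v => f (t : Icc s r) y (m t) u v) ht₂ (x t)
  refine ⟨(h.isCaratheodory (constControl u) ζ).integrable x, fun t => ?_⟩
  rw [integral_congr_ae (ae_restrict_of_ae hae)]
  exact hx t

theorem exists_isProducedBy_of_pathDistribution
    (hf : Continuous
      fun p : Time T × Torus d × ProbabilityMeasure (Torus d) × U × V =>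
        f p.1 p.2.1 p.2.2.1 p.2.2.2.1 p.2.2.2.2)
    (hLip : ∃ L : ℝ, 0 < L ∧ ∀ (t : Time T) (x' x'' : Torus d)
      (m' m'' : ProbabilityMeasure (Torus d)) (u : U) (v : V),
      ‖f t x' m' u v - f t x'' m'' u v‖ ≤ L * (dist x' x'' + wasserstein2 m' m''))
    {mstar : ProbabilityMeasure (Torus d)} {α : ProbabilityMeasure (Torus d × U)}
    (hα : α ∈ withMarginal mstar U) {ν : ProbabilityMeasure (Path d s r × U)}
    (hν₁ : (ν : Measure (Path d s r × U)).map (fun a => (a.1 (startPt hsr), a.2)) = α)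
    (hν₂ : ∀ t : Icc s r, (ν : Measure (Path d s r × U)).map (fun a => a.1 t) = m t)
    (hν₃ : ∀ t' t'' : Icc s r, t' ≤ t'' →
      ∫⁻ a, Metric.infEDist (a.1 t'' - a.1 t')
        (toTorus '' setIntegral ((lebSub s r).restrict (Icc t' t''))
          (fun t => F₁ f t (a.1 t) (m t) a.2)) ∂(ν : Measure (Path d s r × U)) = 0) :
    ∃ κ ∈ consistentPairs V mstar (toRelaxed (T := T) α), IsProducedBy f hsr mstar κ m := by
  obtain ⟨M, L, h⟩ := exists_isAdmissible hf hLip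
    (continuous_flow_of_eq_map (X := Prod.fst) measurable_fst fun t => (hν₂ t).symm)
  have hT : 0 < T := s.2.1.trans_lt (lt_of_lt_of_le hsr r.2.2)
  have hemb := measurableEmbedding_constControl (W := U) hT
  obtain ⟨Z, hZ, hZv⟩ := h.exists_measurable_relaxedControl hsr
  have hgood := h.ae_hasVelocityBounds hsr (TopologicalSpace.denseSeq (Vel d)) hν₃
  let Φ : Path d s r × U → Torus d × RelaxedControl T U × RelaxedControl T V := fun a =>
    (a.1 (startPt hsr), constControl a.2, Z a)
  have heval : Measurable fun a : Path d s r × U => a.1 (startPt hsr) :=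
    (continuous_eval_const _).measurable.comp measurable_fst
  have hΦ : Measurable Φ :=
    heval.prodMk ((hemb.measurable.comp measurable_snd).prodMk hZ)
  have hmot : ∀ᵐ a ∂(ν : Measure (Path d s r × U)), traj f hsr m (Φ a) = a.1 := by
    filter_upwards [hgood] with a ha
    have ht := ha.isTrajectory hsr h (TopologicalSpace.denseRange_denseSeq _)
    exact h.traj_eq hsr (h.isMotion_of_pathVelocity hsr (hZv a ht.1) ht.2)
  -- On the set of full measure where `traj` returns the path, `Φ a` determines both the path and
  -- `u`, so `Φ` is injective there.
  have htraj : AEMeasurable (traj f hsr m) ((ν : Measure (Path d s r × U)).map Φ) := by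
    refine aemeasurable_map_of_ae_leftInverse hΦ measurable_fst hmot (fun a ha b hb hab => ?_)
      fun a ha => ha
    refine Prod.ext ?_ (hemb.injective (congr_arg (fun p => p.2.1) hab))
    rw [← show traj f hsr m (Φ a) = a.1 from ha, hab, show traj f hsr m (Φ b) = b.1 from hb]
  have hfst : (ν : Measure (Path d s r × U)).map (fun a => a.1 (startPt hsr)) = mstar := by
    have h₁ : (ν : Measure (Path d s r × U)).map (fun a => a.1 (startPt hsr)) =
        ((ν : Measure (Path d s r × U)).map (fun a => (a.1 (startPt hsr), a.2))).map Prod.fst := by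
      rw [Measure.map_map measurable_fst (heval.prodMk measurable_snd)]
      rfl
    rw [h₁, hν₁]
    exact hα
  refine ⟨ν.map hΦ.aemeasurable, ⟨?_, ?_⟩, ν.map measurable_fst.aemeasurable, fun t => ?_, ?_, ?_, ?_⟩
  · change ((ν : Measure (Path d s r × U)).map Φ).map Prod.fst = mstar
    rw [Measure.map_map measurable_fst hΦ]
    exact hfst
  · change ((ν : Measure (Path d s r × U)).map Φ).map (fun p => (p.1, p.2.1)) =
      (α : Measure (Torus d × U)).map fun p => (p.1, (constControl p.2 : RelaxedControl T U))
    have hid : Measurable fun p : Torus d × U => (p.1, (constControl p.2 : RelaxedControl T U)) :=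
      measurable_fst.prodMk (hemb.measurable.comp measurable_snd)
    rw [← hν₁, Measure.map_map (by fun_prop) hΦ,
      Measure.map_map hid (heval.prodMk measurable_snd)]
    rfl
  · change (m t : Measure (Torus d)) =
      ((ν : Measure (Path d s r × U)).map Prod.fst).map fun x => x t
    rw [Measure.map_map (continuous_eval_const t).measurable measurable_fst, ← hν₂ t]
    rfl
  · exact ProbabilityMeasure.toMeasure_injective ((hν₂ _).symm.trans hfst)
  · exact htraj
  · change (ν : Measure (Path d s r × U)).map Prod.fst =
      ((ν : Measure (Path d s r × U)).map Φ).map (traj f hsr m)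
    rw [AEMeasurable.map_map_of_aemeasurable htraj hΦ.aemeasurable]
    exact Measure.map_congr (hmot.mono fun a ha => ha.symm)

end ControlDistribution

end MFDG

end

theorem proposition2 {d : ℕ} {T : ℝ} {U V : Type*}
    [MetricSpace U] [CompactSpace U] [Nonempty U] [MeasurableSpace U] [BorelSpace U]
    [MetricSpace V] [CompactSpace V] [Nonempty V] [MeasurableSpace V] [BorelSpace V]
    (f : MFDG.Time T → MFDG.Torus d → ProbabilityMeasure (MFDG.Torus d) → U → V → MFDG.Vel d)
    (hf : Continuous
      fun p : MFDG.Time T × MFDG.Torus d × ProbabilityMeasure (MFDG.Torus d) × U × V =>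
        f p.1 p.2.1 p.2.2.1 p.2.2.2.1 p.2.2.2.2)
    (hLip : ∃ L : ℝ, 0 < L ∧ ∀ (t : MFDG.Time T) (x' x'' : MFDG.Torus d)
      (m' m'' : ProbabilityMeasure (MFDG.Torus d)) (u : U) (v : V),
      ‖f t x' m' u v - f t x'' m'' u v‖ ≤ L * (dist x' x'' + MFDG.wasserstein2 m' m''))
    (s r : MFDG.Time T) (hsr : s < r)
    (mstar : ProbabilityMeasure (MFDG.Torus d))
    (α : ProbabilityMeasure (MFDG.Torus d × U)) (hα : α ∈ MFDG.withMarginal mstar U)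
    (m : Set.Icc s r → ProbabilityMeasure (MFDG.Torus d)) :
    (∃ κ ∈ MFDG.consistentPairs V mstar (MFDG.toRelaxed (T := T) α),
      MFDG.IsProducedBy f hsr mstar κ m) ↔
    ∃ ν : ProbabilityMeasure (MFDG.Path d s r × U),
      (ν : Measure (MFDG.Path d s r × U)).map (fun a => (a.1 (MFDG.startPt hsr), a.2)) = α ∧
      (∀ t : Set.Icc s r,
        (ν : Measure (MFDG.Path d s r × U)).map (fun a => a.1 t) = m t) ∧
      (∀ t' t'' : Set.Icc s r, t' ≤ t'' →
        ∫⁻ a, Metric.infEDist (a.1 t'' - a.1 t')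
          (MFDG.toTorus '' MFDG.setIntegral ((MFDG.lebSub s r).restrict (Set.Icc t' t''))
            (fun t => MFDG.F₁ f t (a.1 t) (m t) a.2))
          ∂(ν : Measure (MFDG.Path d s r × U)) = 0) := by
  constructor
  · rintro ⟨κ, hκ, hm⟩
    exact MFDG.exists_pathDistribution_of_isProducedBy hsr hf hLip hκ hm
  · rintro ⟨ν, hν₁, hν₂, hν₃⟩
    exact MFDG.exists_isProducedBy_of_pathDistribution hsr hf hLip hα hν₁ hν₂ hν₃
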